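/- **Setting.** Let $M\subseteq B(H)$ be a von Neumann algebra on a complex Hilbert space $H$, with commutant $M'$, center $Z(M)=M\cap M'$ and identity $\mathbf 1$. A linear operator $x$ in $H$ is affiliated with $M$ if $u\,\mathcal D(x)\subseteq\mathcal D(x)$ and $ux\xi=xu\xi$ for all $\xi\in\mathcal D(x)$ and all unitaries $u\in M'$. A closed affiliated operator $x$ is *measurable* ($x\in S(M)$) if there are projections $p_n\in M$, $p_n\uparrow\mathbf 1$, with $p_n(H)\subseteq\mathcal D(x)$ and $\mathbf 1-p_n$ finite in $M$; it is *locally measurable* ($x\in LS(M)$) if there are projections $z_n\in Z(M)$, $z_n\uparrow\mathbf 1$, with $z_nx\in S(M)$ for all $n$. Sums and products of such operators are strong ones (closures of the algebraic ones). The *central extension* $E(M)$ of $M$ is the set of all $x\in LS(M)$ for which there is a family $(z_i)_{i\in I}$ of mutually orthogonal projections in $Z(M)$ with $\bigvee_i z_i=\mathbf 1$ and $z_ix\in M$ for all $i\in I$; one has $M\subseteq E(M)$. Let $Z(M)\cong L^\infty(\Omega,\Sigma,\mu)$ be any $*$-isomorphism, where $\mu$ is a semifinite measure (every set of positive measure contains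 a measurable set of finite positive measure) with the direct sum property (there is a family of measurable sets $\Omega_j$, $0<\mu(\Omega_j)<\infty$, such that every measurable set of finite measure is contained, up to a null set, in the union of countably many of the $\Omega_j$). It extends to $S(Z(M))\cong L^0(\Omega,\Sigma,\mu)$. For $x\in E(M)$ put $\|x\|=\inf\{f\in S(Z(M)):|x|\le f\}\in S(Z(M))$. The topology $t_c(M)$ on $E(M)$ is the one for which the sets $x+O(A,\varepsilon,\delta)$, with $A\in\Sigma$, $\mu(A)<\infty$, $\varepsilon,\delta>0$, form a base of neighbourhoods of $x$, where $$O(A,\varepsilon,\delta)=\{x\in E(M):\ \exists B\in\Sigma,\ B\subseteq A,\ \mu(A\setminus B)\le\delta,\ \big\|\,\|x\|\chi_B\big\|_{L^\infty}\le\varepsilon\}.$$ **Theorem.** The following conditions are equivalent: 1. $E(M)=M$; 2. $M=\bigoplus_{k=1}^n M_k$ for finitely many von Neumann factors $M_k$; 3. the center $Z(M)$ is finite-dimensional. In this case the topology $t_c(M)$ coincides with the uniform (operator norm) topology on $M$, whatever identification $Z(M)\cong L^\infty(\Omega,\Sigma,\mu)$ as above is used to define $t_c(M)$. -/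

import Mathlib

open scoped ENNReal

universe u v

namespace CentralExt

section Operators

variable {H : Type u} [NormedAddCommGroup H] [InnerProductSpace ℂ H]

/-- An everywhere defined bounded operator, regarded as a (partially defined) linear operator. -/
def ofBounded (y : H →L[ℂ] H) : H →ₗ.[ℂ] H := (y : H →ₗ[ℂ] H).toPMap ⊤

/-- The natural domain `{ξ ∈ D(x) | x ξ ∈ D(y)}` of the product `y x`. -/
def prodDomain (y x : H →ₗ.[ℂ] H) : Submodule ℂ H :=
  (y.domain.comap x.toFun).map x.domain.subtype

theorem prodDomain_aux (y x : H →ₗ.[ℂ] H) (ξ : (x.domRestrict (prodDomain y x)).domain) :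
    x.domRestrict (prodDomain y x) ξ ∈ y.domain := by
  obtain ⟨ξ, ⟨⟨η, hη, rfl⟩, h2⟩⟩ := ξ
  exact hη

/-- The product `y x` of partially defined operators, on its natural domain. -/
def prod (y x : H →ₗ.[ℂ] H) : H →ₗ.[ℂ] H :=
  y.comp (x.domRestrict (prodDomain y x)) (prodDomain_aux y x)

/-- Strong product: the closure of the product. -/
noncomputable def strongMul (y x : H →ₗ.[ℂ] H) : H →ₗ.[ℂ] H := (prod y x).closure

/-- Strong sum: the closure of the sum, which is defined on `D(x) ∩ D(y)`. -/
noncomputable def strongAdd (x y : H →ₗ.[ℂ] H) : H →ₗ.[ℂ] H := (x + y).closure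

/-- Strong difference: the closure of the difference, which is defined on `D(x) ∩ D(y)`. -/
noncomputable def strongSub (x y : H →ₗ.[ℂ] H) : H →ₗ.[ℂ] H := (x - y).closure

/-- Positivity of a self-adjoint operator: `⟨x ξ, ξ⟩ ≥ 0` for all `ξ ∈ D(x)`. -/
def IsNonneg (x : H →ₗ.[ℂ] H) : Prop :=
  ∀ ξ : x.domain, 0 ≤ (inner ℂ (x ξ) (ξ : H)).re

/-- The order of self-adjoint (locally measurable) operators: the strong difference is positive. -/
def OpLE [CompleteSpace H] (a b : H →ₗ.[ℂ] H) : Prop :=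
  IsSelfAdjoint a ∧ IsSelfAdjoint b ∧ IsNonneg (strongSub b a)

/-- `a = |x|`, i.e. `a` is the positive self-adjoint square root of `x* x`. -/
def IsAbs [CompleteSpace H] (x a : H →ₗ.[ℂ] H) : Prop :=
  IsSelfAdjoint a ∧ IsNonneg a ∧ prod a a = prod (star x) x

/-- The supremum, in the lattice of projections, of a family of projections is `1`: no proper
closed subspace contains all their ranges. -/
def HasSupOne {ι : Type*} (p : ι → H →L[ℂ] H) : Prop :=
  (⨆ i, (p i).range).topologicalClosure = ⊤

/-- `p_n ↑ 1` for a sequence of projections. -/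
def IncreasesToOne (p : ℕ → H →L[ℂ] H) : Prop := Monotone p ∧ HasSupOne p

theorem prod_ofBounded (y x : H →L[ℂ] H) :
    prod (ofBounded y) (ofBounded x) = ofBounded (y * x) := by
  refine LinearPMap.ext ?_ ?_
  · refine top_unique fun ξ _ => ?_
    exact ⟨⟨⟨ξ, trivial⟩, trivial, rfl⟩, trivial⟩
  · intro ξ h1 h2
    rfl

theorem ofBounded_isClosed (y : H →L[ℂ] H) : (ofBounded y).IsClosed := by
  have : ((ofBounded y).graph : Set (H × H)) = {p | y p.1 = p.2} := by
    ext p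
    simp [LinearPMap.mem_graph_iff, ofBounded]
  rw [LinearPMap.IsClosed, this]
  exact isClosed_eq (by fun_prop) (by fun_prop)

theorem closure_of_isClosed {x : H →ₗ.[ℂ] H} (hx : x.IsClosed) : x.closure = x := by
  refine LinearPMap.eq_of_eq_graph ?_
  rw [← hx.isClosable.graph_closure_eq_closure_graph]
  exact IsClosed.submodule_topologicalClosure_eq hx

theorem strongMul_ofBounded (y x : H →L[ℂ] H) :
    strongMul (ofBounded y) (ofBounded x) = ofBounded (y * x) := by
  rw [strongMul, prod_ofBounded, closure_of_isClosed (ofBounded_isClosed _)]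

end Operators

section Algebra

variable {H : Type u} [NormedAddCommGroup H] [InnerProductSpace ℂ H] [CompleteSpace H]

/-- The center `Z(M) = M ∩ M'`, as a von Neumann algebra. -/
noncomputable def center (M : VonNeumannAlgebra H) : VonNeumannAlgebra H where
  toStarSubalgebra := M.toStarSubalgebra ⊓ M.commutant.toStarSubalgebra
  centralizer_centralizer' := by
    refine Set.Subset.antisymm ?_ Set.subset_centralizer_centralizer
    have key : ∀ N : VonNeumannAlgebra H, ∀ S : Set (H →L[ℂ] H), S ⊆ N →
        S.centralizer.centralizer ⊆ (N : Set (H →L[ℂ] H)) := by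
      intro N S hS
      calc S.centralizer.centralizer
          ⊆ (N : Set (H →L[ℂ] H)).centralizer.centralizer :=
            Set.centralizer_subset (Set.centralizer_subset hS)
        _ = N := N.centralizer_centralizer
    intro x hx
    exact ⟨key M _ (fun y hy => hy.1) hx, key M.commutant _ (fun y hy => hy.2) hx⟩

/-- A factor: the center consists of the scalar multiples of the identity. -/
def IsFactor (M : VonNeumannAlgebra H) : Prop :=
  ∀ x ∈ center M, ∃ c : ℂ, x = c • (1 : H →L[ℂ] H)

/-- `M` is the direct sum `M_1 ⊕ ⋯ ⊕ M_n` of von Neumann factors `M_k ⊆ B(K_k)`: for some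
identification of `H` with the Hilbert space sum `K_1 ⊕ ⋯ ⊕ K_n`, the elements of `M` are exactly
the operators `y_1 ⊕ ⋯ ⊕ y_n` with `y_k ∈ M_k`. -/
def IsFiniteDirectSumOfFactors (M : VonNeumannAlgebra H) : Prop :=
  ∃ (n : ℕ) (K : Fin n → Type u) (_ : ∀ k, NormedAddCommGroup (K k))
    (_ : ∀ k, InnerProductSpace ℂ (K k)) (_ : ∀ k, CompleteSpace (K k))
    (N : ∀ k, VonNeumannAlgebra (K k)) (U : H ≃ₗᵢ[ℂ] PiLp 2 K),
    (∀ k, IsFactor (N k)) ∧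
    ∀ x : H →L[ℂ] H, x ∈ M ↔
      ∃ y : ∀ k, K k →L[ℂ] K k, (∀ k, y k ∈ N k) ∧ ∀ (ξ : H) (k : Fin n), U (x ξ) k = y k (U ξ k)

/-- `e ∈ P(M)`. -/
def IsProj (M : VonNeumannAlgebra H) (e : H →L[ℂ] H) : Prop := IsStarProjection e ∧ e ∈ M

/-- `e ∈ P(M)` is finite: it is not equivalent in `M` to a proper subprojection. -/
def IsFiniteProj (M : VonNeumannAlgebra H) (e : H →L[ℂ] H) : Prop :=
  IsProj M e ∧ ∀ w ∈ M, star w * w = e → w * star w ≤ e → w * star w = e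

/-- A linear subspace is affiliated with `M`. -/
def AffiliatedSubspace (M : VonNeumannAlgebra H) (D : Submodule ℂ H) : Prop :=
  ∀ w ∈ M.commutant, w ∈ unitary (H →L[ℂ] H) → ∀ ξ ∈ D, w ξ ∈ D

/-- A linear operator is affiliated with `M`. -/
def Affiliated (M : VonNeumannAlgebra H) (x : H →ₗ.[ℂ] H) : Prop :=
  ∀ w ∈ M.commutant, w ∈ unitary (H →L[ℂ] H) →
    ∀ ξ : x.domain, ∃ h : w ξ ∈ x.domain, w (x ξ) = x ⟨w ξ, h⟩

/-- Strong density of a linear subspace with respect to `M`. -/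
def StronglyDense (M : VonNeumannAlgebra H) (D : Submodule ℂ H) : Prop :=
  AffiliatedSubspace M D ∧ ∃ p : ℕ → H →L[ℂ] H, (∀ n, IsProj M (p n)) ∧ IncreasesToOne p ∧
    ∀ n, (p n).range ≤ D ∧ IsFiniteProj M (1 - p n)

/-- `S(M)`: the operators measurable with respect to `M`. -/
def measurableOps (M : VonNeumannAlgebra H) : Set (H →ₗ.[ℂ] H) :=
  {x | x.IsClosed ∧ Affiliated M x ∧ StronglyDense M x.domain}

/-- `LS(M)`: the operators locally measurable with respect to `M`. -/
def locallyMeasurableOps (M : VonNeumannAlgebra H) : Set (H →ₗ.[ℂ] H) :=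
  {x | x.IsClosed ∧ Affiliated M x ∧ ∃ z : ℕ → H →L[ℂ] H, (∀ n, IsProj (center M) (z n)) ∧
    IncreasesToOne z ∧ ∀ n, strongMul (ofBounded (z n)) x ∈ measurableOps M}

/-- `M`, regarded as a set of linear operators on `H`. -/
def boundedOps (M : VonNeumannAlgebra H) : Set (H →ₗ.[ℂ] H) := ofBounded '' (M : Set (H →L[ℂ] H))

/-- `E(M)`: the central extension of `M`. The family of central projections is given as a set. -/
def centralExtension (M : VonNeumannAlgebra H) : Set (H →ₗ.[ℂ] H) :=
  {x | x ∈ locallyMeasurableOps M ∧ ∃ Z : Set (H →L[ℂ] H), (∀ z ∈ Z, IsProj (center M) z) ∧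
    (∀ z ∈ Z, ∀ w ∈ Z, z ≠ w → z * w = 0) ∧ HasSupOne (fun z : Z => (z : H →L[ℂ] H)) ∧
    ∀ z ∈ Z, strongMul (ofBounded z) x ∈ boundedOps M}

theorem isProj_one (M : VonNeumannAlgebra H) : IsProj M 1 :=
  ⟨IsStarProjection.one _, one_mem M⟩

theorem hasSupOne_one {ι : Type*} [Nonempty ι] {p : ι → H →L[ℂ] H} (hp : ∀ i, p i = 1) :
    HasSupOne p := by
  refine top_unique (le_trans ?_ (Submodule.le_topologicalClosure _))
  refine le_trans ?_ (le_iSup _ (Classical.arbitrary ι))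
  rintro ξ -
  exact ⟨ξ, by simp [hp]⟩

theorem increasesToOne_one : IncreasesToOne (fun _ => (1 : H →L[ℂ] H)) := by
  exact ⟨monotone_const, hasSupOne_one fun _ => rfl⟩

theorem ofBounded_mem_measurableOps {M : VonNeumannAlgebra H} {y : H →L[ℂ] H} (hy : y ∈ M) :
    ofBounded y ∈ measurableOps M := by
  refine ⟨ofBounded_isClosed y, ?_, ?_, fun _ => 1, fun _ => isProj_one M, increasesToOne_one, ?_⟩
  · intro w hw _ ξ
    refine ⟨trivial, ?_⟩
    have := VonNeumannAlgebra.mem_commutant_iff.1 hw y hy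
    exact (DFunLike.congr_fun this (ξ : H)).symm
  · intro w _ _ ξ _
    exact trivial
  · refine fun n => ⟨fun _ _ => trivial, ⟨?_, ?_⟩, ?_⟩
    · simp
    · simp
    · intro w _ h1 _
      have h0 : star w * w = 0 := by simpa using! h1
      have : w = 0 := CStarRing.star_mul_self_eq_zero_iff w |>.1 h0
      simp [this]

/-- `M ⊆ E(M)`. -/
theorem boundedOps_subset_centralExtension (M : VonNeumannAlgebra H) :
    boundedOps M ⊆ centralExtension M := by
  rintro _ ⟨y, hy, rfl⟩
  have h1 : strongMul (ofBounded 1) (ofBounded y) = ofBounded y := by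
    rw [strongMul_ofBounded, one_mul]
  have hm := ofBounded_mem_measurableOps (M := M) hy
  refine ⟨⟨hm.1, hm.2.1, fun _ => 1, fun _ => isProj_one _, increasesToOne_one, fun _ => ?_⟩,
    {1}, ?_, ?_, ?_, ?_⟩
  · rw [h1]; exact hm
  · rintro z rfl; exact isProj_one _
  · rintro z rfl w rfl h; exact absurd rfl h
  · exact hasSupOne_one fun i => i.2
  · rintro z rfl
    rw [h1]; exact ⟨y, hy, rfl⟩

/-- The inclusion `M → E(M)`. -/
def toCentralExtension (M : VonNeumannAlgebra H) (y : M) : centralExtension M :=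
  ⟨ofBounded (y : H →L[ℂ] H), boundedOps_subset_centralExtension M ⟨y, y.2, rfl⟩⟩

/-- `f = ‖x‖ = inf {g ∈ S(Z(M)) : |x| ≤ g}`, the infimum being taken in `S(Z(M))`. -/
def IsVectorNorm (M : VonNeumannAlgebra H) (x f : H →ₗ.[ℂ] H) : Prop :=
  ∃ a, IsAbs x a ∧ f ∈ measurableOps (center M) ∧
    (∀ g ∈ measurableOps (center M), OpLE a g → OpLE f g) ∧
    ∀ f' ∈ measurableOps (center M),
      (∀ g ∈ measurableOps (center M), OpLE a g → OpLE f' g) → OpLE f' f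

end Algebra

section Topology

open MeasureTheory

/-- The direct sum property of a measure. The last clause makes explicit that sets which are null
inside every set of finite measure are null sets. -/
def DirectSumProperty {Ω : Type v} [MeasurableSpace Ω] (μ : Measure Ω) : Prop :=
  (∃ J : Set (Set Ω), (∀ B ∈ J, MeasurableSet B ∧ 0 < μ B ∧ μ B < ∞) ∧
    ∀ A, MeasurableSet A → μ A < ∞ → ∃ J₀ ⊆ J, J₀.Countable ∧ μ (A \ ⋃₀ J₀) = 0) ∧
  ∀ A, MeasurableSet A → (∀ B, MeasurableSet B → μ B < ∞ → μ (A ∩ B) = 0) → μ A = 0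

variable {H : Type u} [NormedAddCommGroup H] [InnerProductSpace ℂ H] [CompleteSpace H]

/-- An identification `Z(M) ≅ L^∞(Ω, Σ, μ)`: a `*`-isomorphism of `Z(M)` onto the algebra of
essentially bounded functions inside `L^0(Ω, Σ, μ)`. -/
structure CenterModel (M : VonNeumannAlgebra H) {Ω : Type v} [MeasurableSpace Ω]
    (μ : Measure Ω) where
  toHom : (center M).toStarSubalgebra →ₗ[ℂ] (Ω →ₘ[μ] ℂ)
  map_one : toHom 1 = 1
  map_mul : ∀ x y, toHom (x * y) = toHom x * toHom y
  map_star : ∀ x, toHom (star x) = star (toHom x)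
  injective : Function.Injective toHom
  range_eq : Set.range toHom = (Lp ℂ ∞ μ : Set (Ω →ₘ[μ] ℂ))

variable {M : VonNeumannAlgebra H} {Ω : Type v} [MeasurableSpace Ω] {μ : Measure Ω}

/-- `f ∈ S(Z(M))` corresponds to `g ∈ L^0(Ω, Σ, μ)` under the identification `S(Z(M)) ≅ L^0`, the
multiplicative extension of `Z(M) ≅ L^∞`: whenever `e` and `e f` lie in `Z(M)`, the function of `e f`
is the function of `e` times `g`. -/
def CenterModel.Corresponds (Φ : CenterModel M μ) (f : H →ₗ.[ℂ] H) (g : Ω →ₘ[μ] ℂ) : Prop :=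
  f ∈ measurableOps (center M) ∧
    ∀ e y : (center M).toStarSubalgebra,
      strongMul (ofBounded (e : H →L[ℂ] H)) f = ofBounded (y : H →L[ℂ] H) →
        Φ.toHom y = Φ.toHom e * g

/-- The basic neighbourhoods `W(A, ε, δ)` of zero for convergence locally in measure on `L^0`. -/
def nhdW (μ : Measure Ω) (A : Set Ω) (ε δ : ℝ) : Set (Ω →ₘ[μ] ℂ) :=
  {g | ∃ B, MeasurableSet B ∧ B ⊆ A ∧ μ (A \ B) ≤ ENNReal.ofReal δ ∧
    eLpNorm (B.indicator g) ∞ μ ≤ ENNReal.ofReal ε}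

/-- `O(A, ε, δ) = {x ∈ E(M) : ‖x‖ ∈ W(A, ε, δ)}`. -/
def CenterModel.nhdO (Φ : CenterModel M μ) (A : Set Ω) (ε δ : ℝ) : Set (H →ₗ.[ℂ] H) :=
  {x | x ∈ centralExtension M ∧
    ∃ f g, IsVectorNorm M x f ∧ Φ.Corresponds f g ∧ g ∈ nhdW μ A ε δ}

/-- The translate `x + O(A, ε, δ)`, as a subset of `E(M)`. -/
def CenterModel.nhdOAt (Φ : CenterModel M μ) (x : centralExtension M) (A : Set Ω) (ε δ : ℝ) :
    Set (centralExtension M) :=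
  {y | ∃ w ∈ Φ.nhdO A ε δ, (y : H →ₗ.[ℂ] H) = strongAdd x w}

/-- The topology `t_c(M)` on `E(M)`: the sets `x + O(A, ε, δ)` with `μ(A) < ∞` and `ε, δ > 0` form
a base of neighbourhoods of `x`. -/
@[reducible]
def CenterModel.tc (Φ : CenterModel M μ) : TopologicalSpace (centralExtension M) :=
  TopologicalSpace.mkOfNhds fun x =>
    ⨅ (A : Set Ω) (_ : MeasurableSet A) (_ : μ A < ∞) (ε : ℝ) (_ : 0 < ε) (δ : ℝ) (_ : 0 < δ),
      Filter.principal (Φ.nhdOAt x A ε δ)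

end Topology

end CentralExt

/-! Everything is decided by orthogonal families in the center. If $Z(M)$ is infinite-dimensional,
its Gelfand spectrum is infinite and so contains infinitely many disjoint nonempty open sets;
Urysohn functions on them give nonzero orthogonal central elements. Their range projections,
completed by the projection onto what is left, form a sequence $z_n$ with supremum $1$
(`exists_seq_central_projections`). The operator $\sum 2^n z_n$, realised as the inverse of the
bounded injective operator $\sum 2^{-n} z_n$, then lies in $E(M)$ and is unbounded
(`finiteDimensional_center_of_eq`).

If $Z(M)$ is finite-dimensional, orthogonal families of central projections are finite, so an
element of $E(M)$ is a finite sum of bounded pieces (`centralExtension_eq_of_finiteDimensional`).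
The center is spanned by orthogonal projections $e_k$ with sum $1$, and $M$ splits into its corners
on the spaces $e_kH$, which are factors (`isFiniteDirectSumOfFactors_of_finiteDimensional`).
Conversely, a central element of a finite sum of factors is a scalar in each summand
(`finiteDimensional_of_isFiniteDirectSumOfFactors`).

For the topology, $\|x\| = \sum_k \|e_k|x|e_k\|\,e_k$ (`isVectorNorm_central_sum`), so the vector
norm amounts to finitely many coefficients which together control the operator norm and are
controlled by it. Each $e_k$ is a non-null function, so for one suitable $A$ of finite measure and
small $\delta$ no admissible $B$ can miss its support, and $O(A,\varepsilon,\delta)$ bounds every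
coefficient (`CenterModel.exists_norm_le_of_mem_nhdW`). -/

namespace CentralExt


/-! ### Bounded operators among partially defined ones. -/

section BoundedOperators

variable {H : Type u} [NormedAddCommGroup H] [InnerProductSpace ℂ H]

theorem ofBounded_injective : Function.Injective (ofBounded (H := H)) := by
  intro x y h
  ext ξ
  exact congrArg (fun f : H →ₗ.[ℂ] H => ∃ h : ξ ∈ f.domain, f ⟨ξ, h⟩ = y ξ) h |>.mpr ⟨trivial, rfl⟩ |>.2

@[simp]
theorem ofBounded_inj {x y : H →L[ℂ] H} : ofBounded x = ofBounded y ↔ x = y :=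
  ofBounded_injective.eq_iff

@[simp]
theorem ofBounded_apply (y : H →L[ℂ] H) (ξ : (ofBounded y).domain) : ofBounded y ξ = y ξ := rfl

theorem mem_graph_ofBounded {y : H →L[ℂ] H} {p : H × H} :
    p ∈ (ofBounded y).graph ↔ y p.1 = p.2 := by
  simp [LinearPMap.mem_graph_iff, ofBounded]

theorem strongAdd_ofBounded (x y : H →L[ℂ] H) :
    strongAdd (ofBounded x) (ofBounded y) = ofBounded (x + y) := by
  have : ofBounded x + ofBounded y = ofBounded (x + y) :=
    LinearPMap.ext (top_inf_eq _) fun ξ _ _ => rfl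
  rw [strongAdd, this, closure_of_isClosed (ofBounded_isClosed _)]

theorem strongSub_ofBounded (x y : H →L[ℂ] H) :
    strongSub (ofBounded x) (ofBounded y) = ofBounded (x - y) := by
  have : ofBounded x - ofBounded y = ofBounded (x - y) :=
    LinearPMap.ext (top_inf_eq _) fun ξ _ _ => rfl
  rw [strongSub, this, closure_of_isClosed (ofBounded_isClosed _)]

/-- A densely defined restriction of a bounded operator has that operator as closure. -/
theorem closure_eq_ofBounded {f : H →ₗ.[ℂ] H} {T : H →L[ℂ] H}
    (hd : Dense (f.domain : Set H)) (h : ∀ ξ : f.domain, f ξ = T ξ) :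
    f.closure = ofBounded T := by
  have hle : f ≤ ofBounded T := ⟨le_top, fun ξ η e => by rw [h, ofBounded_apply, e]⟩
  have hc : f.IsClosable := (ofBounded_isClosed T).isClosable.leIsClosable hle
  refine LinearPMap.eq_of_eq_graph ?_
  rw [← hc.graph_closure_eq_closure_graph]
  refine le_antisymm ?_ ?_
  · exact Submodule.topologicalClosure_minimal _ (LinearPMap.le_graph_of_le hle)
      (ofBounded_isClosed T)
  · rintro ⟨ξ, η⟩ hξ
    rw [mem_graph_ofBounded] at hξ
    dsimp only at hξ
    subst hξ
    have hm : Set.MapsTo (fun ξ => (ξ, T ξ)) (f.domain : Set H) (f.graph : Set (H × H)) := by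
      intro ξ hξ
      have := f.mem_graph ⟨ξ, hξ⟩
      rwa [h] at this
    exact hm.closure (by fun_prop) (hd ξ)

/-- A closed everywhere defined operator is bounded. -/
theorem exists_eq_ofBounded [CompleteSpace H] {x : H →ₗ.[ℂ] H} (hc : x.IsClosed)
    (hd : x.domain = ⊤) : ∃ y : H →L[ℂ] H, x = ofBounded y := by
  let g : H →ₗ[ℂ] H := x.toFun ∘ₗ (LinearEquiv.ofTop x.domain hd).symm.toLinearMap
  have hx : x = g.toPMap ⊤ := by
    refine LinearPMap.ext hd fun ξ h1 h2 => rfl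
  have hg : IsClosed (g.graph : Set (H × H)) := by
    have : (g.graph : Set (H × H)) = x.graph := by
      ext p
      rw [hx]
      simp [LinearPMap.mem_graph_iff, LinearMap.mem_graph_iff, eq_comm]
    rw [this]
    exact hc
  exact ⟨ContinuousLinearMap.ofIsClosedGraph hg, hx⟩

theorem prod_domain_le (y x : H →ₗ.[ℂ] H) : (prod y x).domain ≤ x.domain :=
  fun _ h => h.2

theorem prod_ofBounded_left_domain (y : H →L[ℂ] H) (x : H →ₗ.[ℂ] H) :
    (prod (ofBounded y) x).domain = x.domain :=
  le_antisymm (prod_domain_le _ _) fun ξ h => ⟨⟨⟨ξ, h⟩, trivial, rfl⟩, h⟩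

theorem prod_ofBounded_left_apply (y : H →L[ℂ] H) (x : H →ₗ.[ℂ] H)
    (ξ : (prod (ofBounded y) x).domain) :
    prod (ofBounded y) x ξ = y (x ⟨ξ, prod_domain_le _ _ ξ.2⟩) := rfl

variable [CompleteSpace H]

theorem star_ofBounded (y : H →L[ℂ] H) : star (ofBounded y) = ofBounded (star y) :=
  ContinuousLinearMap.toPMap_adjoint_eq_adjoint_toPMap_of_dense y dense_univ

theorem isSelfAdjoint_ofBounded {y : H →L[ℂ] H} :
    IsSelfAdjoint (ofBounded y) ↔ IsSelfAdjoint y := by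
  rw [IsSelfAdjoint, star_ofBounded, ofBounded_inj, IsSelfAdjoint]

theorem isNonneg_ofBounded {y : H →L[ℂ] H} (hy : IsSelfAdjoint y) :
    IsNonneg (ofBounded y) ↔ 0 ≤ y := by
  rw [ContinuousLinearMap.nonneg_iff_isPositive, ContinuousLinearMap.IsPositive,
    and_iff_right (ContinuousLinearMap.isSelfAdjoint_iff_isSymmetric.1 hy)]
  exact ⟨fun h ξ => h ⟨ξ, trivial⟩, fun h ξ => h ξ⟩

theorem opLE_ofBounded {x y : H →L[ℂ] H} :
    OpLE (ofBounded x) (ofBounded y) ↔ IsSelfAdjoint x ∧ IsSelfAdjoint y ∧ x ≤ y := by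
  rw [OpLE, isSelfAdjoint_ofBounded, isSelfAdjoint_ofBounded, strongSub_ofBounded]
  refine and_congr_right fun hx => and_congr_right fun hy => ?_
  rw [isNonneg_ofBounded (hy.sub hx), sub_nonneg]

/-- The absolute value of a bounded operator is the bounded positive square root of `w* w`. -/
theorem isAbs_ofBounded {w : H →L[ℂ] H} {a : H →ₗ.[ℂ] H} :
    IsAbs (ofBounded w) a ↔ ∃ b : H →L[ℂ] H, a = ofBounded b ∧ 0 ≤ b ∧ b * b = star w * w := by
  constructor
  · rintro ⟨hs, hn, he⟩
    rw [star_ofBounded, prod_ofBounded] at he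
    -- The square of `a` is everywhere defined, hence so is `a`; being self-adjoint it is closed,
    -- and the closed graph theorem applies.
    have hd : a.domain = ⊤ := by
      refine top_unique fun ξ _ => prod_domain_le a a ?_
      rw [he]
      trivial
    obtain ⟨b, rfl⟩ := exists_eq_ofBounded hs.isClosed hd
    rw [prod_ofBounded, ofBounded_inj] at he
    exact ⟨b, rfl, (isNonneg_ofBounded (isSelfAdjoint_ofBounded.1 hs)).1 hn, he⟩
  · rintro ⟨b, rfl, hb, he⟩
    have hs : IsSelfAdjoint b := IsSelfAdjoint.of_nonneg hb
    refine ⟨isSelfAdjoint_ofBounded.2 hs, (isNonneg_ofBounded hs).2 hb, ?_⟩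
    rw [star_ofBounded, prod_ofBounded, prod_ofBounded, he]

end BoundedOperators

/-! ### Membership criteria from the double commutant theorem. -/

section VonNeumann

variable {H : Type u} [NormedAddCommGroup H] [InnerProductSpace ℂ H] [CompleteSpace H]

theorem isClosed_toStarSubalgebra (N : VonNeumannAlgebra H) :
    IsClosed (N.toStarSubalgebra : Set (H →L[ℂ] H)) := by
  rw [VonNeumannAlgebra.coe_toStarSubalgebra, ← VonNeumannAlgebra.centralizer_centralizer]
  exact Set.isClosed_centralizer _

theorem smul_mem_of_mem (N : VonNeumannAlgebra H) (c : ℂ) {x : H →L[ℂ] H} (hx : x ∈ N) :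
    c • x ∈ N :=
  N.toStarSubalgebra.smul_mem hx c

theorem mem_center_iff {M : VonNeumannAlgebra H} {x : H →L[ℂ] H} :
    x ∈ center M ↔ x ∈ M ∧ ∀ y ∈ M, y * x = x * y := by
  refine Iff.trans (b := x ∈ M ∧ x ∈ M.commutant) Iff.rfl ?_
  rw [VonNeumannAlgebra.mem_commutant_iff]

theorem mem_of_mem_center {M : VonNeumannAlgebra H} {x : H →L[ℂ] H} (hx : x ∈ center M) : x ∈ M :=
  (mem_center_iff.1 hx).1

theorem mem_of_commute {N : VonNeumannAlgebra H} {y : H →L[ℂ] H}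
    (h : ∀ w ∈ N.commutant, w * y = y * w) : y ∈ N := by
  rw [← VonNeumannAlgebra.commutant_commutant N, VonNeumannAlgebra.mem_commutant_iff]
  exact h

/-- An element commuting with the unitaries of the commutant lies in the algebra. -/
theorem mem_of_commute_unitary {N : VonNeumannAlgebra H} {y : H →L[ℂ] H}
    (h : ∀ w ∈ N.commutant, w ∈ unitary (H →L[ℂ] H) → w * y = y * w) : y ∈ N := by
  -- Closedness makes the commutant a C*-algebra, so the four unitaries that combine to `w` can be
  -- chosen inside it.
  have := isClosed_toStarSubalgebra N.commutant
  refine mem_of_commute fun w hw => ?_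
  obtain ⟨u, c, hu, -⟩ := CStarAlgebra.exists_sum_four_unitary
    (⟨w, hw⟩ : N.commutant.toStarSubalgebra)
  have hu' : w = ∑ i, c i • ((u i : N.commutant.toStarSubalgebra) : H →L[ℂ] H) := by
    simpa using congrArg Subtype.val hu
  rw [hu', Finset.sum_mul, Finset.mul_sum]
  refine Finset.sum_congr rfl fun i _ => ?_
  rw [smul_mul_assoc, mul_smul_comm, h _ (u i).1.2]
  have h1 := congrArg Subtype.val (Unitary.star_mul_self_of_mem (u i).2)
  have h2 := congrArg Subtype.val (Unitary.mul_star_self_of_mem (u i).2)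
  exact Unitary.mem_iff.2 ⟨h1, h2⟩

theorem mem_of_affiliated {N : VonNeumannAlgebra H} {y : H →L[ℂ] H}
    (h : Affiliated N (ofBounded y)) : y ∈ N := by
  refine mem_of_commute_unitary fun w hw hu => ?_
  ext ξ
  obtain ⟨_, h2⟩ := h w hw hu ⟨ξ, trivial⟩
  exact h2

/-- Invariance of `K` alone suffices, with no condition on its complement, because the commutant is
closed under adjoints. -/
theorem starProjection_mem {N : VonNeumannAlgebra H} (K : Submodule ℂ H)
    [K.HasOrthogonalProjection] (h : ∀ w ∈ N.commutant, ∀ ξ ∈ K, w ξ ∈ K) :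
    IsProj N K.starProjection := by
  refine ⟨isStarProjection_starProjection, ?_⟩
  rw [VonNeumannAlgebra.IsStarProjection.mem_iff isStarProjection_starProjection]
  intro w hw
  rw [Submodule.range_starProjection]
  exact h w hw

theorem isProj_center_left {M : VonNeumannAlgebra H} {z : H →L[ℂ] H} (hz : IsProj (center M) z) :
    IsProj M z := ⟨hz.1, mem_of_mem_center hz.2⟩

end VonNeumann


/-! ### Commutative C*-algebras through their Gelfand spectrum. -/

section CommutativeCStar

open WeakDual

/-- Mutually orthogonal nonzero elements of a C*-algebra are linearly independent. -/
theorem linearIndependent_of_star_mul_eq_zero {A ι : Type*} [CStarAlgebra A] {a : ι → A}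
    (h0 : ∀ i, a i ≠ 0) (h : ∀ i j, i ≠ j → star (a i) * a j = 0) : LinearIndependent ℂ a := by
  rw [linearIndependent_iff']
  intro s c hs i hi
  have h1 : star (a i) * ∑ j ∈ s, c j • a j = c i • (star (a i) * a i) := by
    rw [Finset.mul_sum, Finset.sum_eq_single_of_mem i hi, mul_smul_comm]
    intro j _ hj
    rw [mul_smul_comm, h i j hj.symm, smul_zero]
  rw [hs, mul_zero, eq_comm, smul_eq_zero, CStarRing.star_mul_self_eq_zero_iff] at h1
  exact h1.resolve_right (h0 i)

variable {A : Type*} [CommCStarAlgebra A]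

/-- An infinite Hausdorff space has infinitely many pairwise disjoint nonempty open sets. Urysohn
functions supported in them are orthogonal and nonzero, and the Gelfand isomorphism carries them
back to `A`. -/
theorem exists_seq_orthogonal_of_infinite [Infinite (characterSpace ℂ A)] :
    ∃ a : ℕ → A, (∀ n, a n ≠ 0) ∧ ∀ m n, m ≠ n → star (a m) * a n = 0 := by
  obtain ⟨U, hU, hUo, hd⟩ := exists_seq_infinite_isOpen_pairwise_disjoint (characterSpace ℂ A)
  have key : ∀ n, ∃ f : C(characterSpace ℂ A, ℝ), f ≠ 0 ∧ ∀ x ∉ U n, f x = 0 := by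
    intro n
    obtain ⟨x, hx⟩ := (hU n).nonempty
    obtain ⟨f, hf0, hf1, -⟩ := exists_continuous_zero_one_of_isClosed (hUo n).isClosed_compl
      (isClosed_singleton (x := x)) (by simpa using hx)
    refine ⟨f, fun h => ?_, fun y hy => hf0 hy⟩
    have := hf1 (Set.mem_singleton x)
    simp [h] at this
  choose f hf0 hf using key
  let g : ℕ → C(characterSpace ℂ A, ℂ) := fun n => ⟨fun x => (f n x : ℂ), by fun_prop⟩
  refine ⟨fun n => (gelfandStarTransform A).symm (g n), fun n => ?_, fun m n hmn => ?_⟩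
  · rw [Ne, EmbeddingLike.map_eq_zero_iff]
    intro h
    refine hf0 n (ContinuousMap.ext fun x => ?_)
    exact Complex.ofReal_eq_zero.1 (DFunLike.congr_fun h x)
  · rw [← map_star, ← map_mul, EmbeddingLike.map_eq_zero_iff]
    ext x
    by_cases hx : x ∈ U m
    · have : x ∉ U n := fun h => Set.disjoint_left.1 (hd hmn) hx h
      simp [g, hf n x this]
    · simp [g, hf m x hx]

theorem finiteDimensional_of_finite_characterSpace [Finite (characterSpace ℂ A)] :
    FiniteDimensional ℂ A := by
  have := Fintype.ofFinite (characterSpace ℂ A)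
  let φ : A →ₗ[ℂ] (characterSpace ℂ A → ℂ) :=
    { toFun := fun a => gelfandStarTransform A a
      map_add' := fun a b => by rw [map_add]; rfl
      map_smul' := fun c a => by rw [map_smul]; rfl }
  refine FiniteDimensional.of_injective φ fun a b h => ?_
  exact (gelfandStarTransform A).injective (DFunLike.coe_injective h)

/-- Otherwise the orthogonal sequence of `exists_seq_orthogonal_of_infinite` would be an infinite
linearly independent family. -/
theorem finite_characterSpace [FiniteDimensional ℂ A] : Finite (characterSpace ℂ A) := by
  by_contra h
  rw [not_finite_iff_infinite] at h
  obtain ⟨a, h0, ha⟩ := exists_seq_orthogonal_of_infinite (A := A)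
  have := (linearIndependent_of_star_mul_eq_zero h0 ha).finite
  exact not_finite ℕ

/-- A finite-dimensional commutative C*-algebra is spanned by finitely many mutually orthogonal
nonzero projections with sum `1`. -/
theorem exists_minimal_projections [FiniteDimensional ℂ A] :
    ∃ (n : ℕ) (e : Fin n → A), (∀ i, IsStarProjection (e i)) ∧ (∀ i, e i ≠ 0) ∧
      (∀ i j, i ≠ j → e i * e j = 0) ∧ ∀ x, ∃ c : Fin n → ℂ, x = ∑ i, c i • e i := by
  classical
  have := finite_characterSpace (A := A)
  obtain ⟨n, ⟨σ⟩⟩ := Finite.exists_equiv_fin (characterSpace ℂ A)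
  -- Indicators of the points of the spectrum, continuous because a finite Hausdorff space is
  -- discrete.
  let g : Fin n → C(characterSpace ℂ A, ℂ) := fun i =>
    ⟨fun x => if σ x = i then 1 else 0, continuous_of_discreteTopology⟩
  refine ⟨n, fun i => (gelfandStarTransform A).symm (g i), fun i => ?_, fun i => ?_,
    fun i j hij => ?_, fun x => ⟨fun i => gelfandStarTransform A x (σ.symm i), ?_⟩⟩
  · refine ⟨?_, ?_⟩
    · rw [IsIdempotentElem, ← map_mul]
      congr 1
      ext x
      simp [g]
    · rw [IsSelfAdjoint, ← map_star]
      congr 1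
      ext x
      by_cases h : σ x = i <;> simp [g, h]
  · rw [Ne, EmbeddingLike.map_eq_zero_iff]
    intro h
    have := DFunLike.congr_fun h (σ.symm i)
    simp [g] at this
  · rw [← map_mul, EmbeddingLike.map_eq_zero_iff]
    ext x
    by_cases h : σ x = i <;> simp [g, h, hij]
  · apply EmbeddingLike.injective (gelfandStarTransform A)
    rw [map_sum]
    ext y
    simp_rw [map_smul, StarAlgEquiv.apply_symm_apply]
    simp [g, ContinuousMap.sum_apply]

end CommutativeCStar

/-! ### Orthogonal projections in the center. -/

section Center

variable {H : Type u} [NormedAddCommGroup H] [InnerProductSpace ℂ H] [CompleteSpace H]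

/-- The center as a commutative C*-algebra. -/
@[reducible]
noncomputable def centerCommCStarAlgebra (M : VonNeumannAlgebra H) :
    CommCStarAlgebra (center M).toStarSubalgebra :=
  have := isClosed_toStarSubalgebra (center M)
  { StarSubalgebra.cstarAlgebra (center M).toStarSubalgebra with
    mul_comm := fun x y => Subtype.ext ((mem_center_iff.1 y.2).2 x (mem_of_mem_center x.2)) }

theorem exists_seq_orthogonal_center (M : VonNeumannAlgebra H)
    (h : ¬ FiniteDimensional ℂ (center M).toStarSubalgebra) :
    ∃ a : ℕ → H →L[ℂ] H, (∀ n, a n ∈ center M) ∧ (∀ n, a n ≠ 0) ∧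
      ∀ m n, m ≠ n → star (a m) * a n = 0 := by
  let _ := centerCommCStarAlgebra M
  have hX : Infinite (WeakDual.characterSpace ℂ (center M).toStarSubalgebra) := by
    rw [← not_finite_iff_infinite]
    exact fun hf => h finiteDimensional_of_finite_characterSpace
  obtain ⟨a, h0, ha⟩ := exists_seq_orthogonal_of_infinite (A := (center M).toStarSubalgebra)
  exact ⟨fun n => a n, fun n => (a n).2, fun n hn => h0 n (Subtype.ext hn),
    fun m n hmn => congrArg Subtype.val (ha m n hmn)⟩

theorem exists_minimal_central_projections (M : VonNeumannAlgebra H)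
    (h : FiniteDimensional ℂ (center M).toStarSubalgebra) :
    ∃ (n : ℕ) (e : Fin n → H →L[ℂ] H), (∀ i, IsProj (center M) (e i)) ∧ (∀ i, e i ≠ 0) ∧
      (∀ i j, i ≠ j → e i * e j = 0) ∧ ∑ i, e i = 1 ∧
      ∀ x ∈ center M, ∃ c : Fin n → ℂ, x = ∑ i, c i • e i := by
  let _ := centerCommCStarAlgebra M
  obtain ⟨n, e, he, h0, ho, hs⟩ := exists_minimal_projections (A := (center M).toStarSubalgebra)
  have hsum : ∑ i, e i = 1 := by
    obtain ⟨c, hc⟩ := hs 1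
    rw [hc]
    refine Finset.sum_congr rfl fun i _ => ?_
    -- Multiplying the expansion of `1` by `e i` leaves only the `i`-th term.
    have h1 : e i = c i • e i := by
      conv_lhs => rw [← mul_one (e i), hc, Finset.mul_sum]
      rw [Finset.sum_eq_single i, mul_smul_comm, (he i).isIdempotentElem.eq]
      · intro j _ hj
        rw [mul_smul_comm, ho i j hj.symm, smul_zero]
      · simp
    exact h1
  refine ⟨n, fun i => e i, fun i => ⟨⟨?_, ?_⟩, (e i).2⟩, fun i hi => h0 i (Subtype.ext hi),
    fun i j hij => congrArg Subtype.val (ho i j hij), ?_, fun x hx => ?_⟩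
  · exact congrArg Subtype.val (he i).1
  · exact congrArg Subtype.val (he i).2
  · simpa using congrArg Subtype.val hsum
  · obtain ⟨c, hc⟩ := hs ⟨x, hx⟩
    exact ⟨c, by simpa using congrArg Subtype.val hc⟩

/-- Mutually orthogonal nonzero projections in a finite-dimensional center form a finite set. -/
theorem finite_of_orthogonal_center {M : VonNeumannAlgebra H}
    (h : FiniteDimensional ℂ (center M).toStarSubalgebra) {Z : Set (H →L[ℂ] H)}
    (hZ : ∀ z ∈ Z, IsProj (center M) z) (ho : ∀ z ∈ Z, ∀ w ∈ Z, z ≠ w → z * w = 0) :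
    Z.Finite := by
  let _ := centerCommCStarAlgebra M
  -- The zero projection may belong to `Z`, so it is removed before independence is invoked and
  -- restored at the end.
  have hli : LinearIndependent ℂ
      (fun z : ↥(Z \ {0}) => (⟨z, (hZ z z.2.1).2⟩ : (center M).toStarSubalgebra)) := by
    refine linearIndependent_of_star_mul_eq_zero (fun z hz => z.2.2 (congrArg Subtype.val hz)) ?_
    intro z w hzw
    refine Subtype.ext ?_
    change star (z : H →L[ℂ] H) * (w : H →L[ℂ] H) = 0
    rw [(hZ z z.2.1).1.isSelfAdjoint.star_eq]
    exact ho z z.2.1 w w.2.1 fun h => hzw (Subtype.ext h)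
  have : (Z \ {0}).Finite := Set.finite_coe_iff.1 hli.finite
  exact (this.union (Set.finite_singleton 0)).subset (by simp)

/-- An infinite-dimensional center contains a sequence of mutually orthogonal projections with
supremum `1`, all but the first of which are nonzero. -/
theorem exists_seq_central_projections (M : VonNeumannAlgebra H)
    (h : ¬ FiniteDimensional ℂ (center M).toStarSubalgebra) :
    ∃ z : ℕ → H →L[ℂ] H, (∀ n, IsProj (center M) (z n)) ∧ (∀ n, z (n + 1) ≠ 0) ∧
      (∀ m n, m ≠ n → z m * z n = 0) ∧ HasSupOne z := by
  obtain ⟨a, ha, h0, ho⟩ := exists_seq_orthogonal_center M h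
  -- The projections sought are those onto the closed ranges of the `a n`, together with the one
  -- onto the orthogonal complement `L` of all of them.
  let K : ℕ → Submodule ℂ H := fun n => (a n).range.topologicalClosure
  let L : Submodule ℂ H := (⨆ n, K n)ᗮ
  have hKc : ∀ n, IsClosed (K n : Set H) := fun n => Submodule.isClosed_topologicalClosure _
  have hK : ∀ n, (K n).HasOrthogonalProjection := fun n =>
    have := (hKc n).completeSpace_coe
    inferInstance
  have hinv : ∀ w ∈ (center M).commutant, ∀ n, ∀ ξ ∈ K n, w ξ ∈ K n := by
    intro w hw n
    have hm : Set.MapsTo w (a n).range (a n).range := by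
      rintro _ ⟨η, rfl⟩
      refine ⟨w η, ?_⟩
      exact DFunLike.congr_fun (VonNeumannAlgebra.mem_commutant_iff.1 hw _ (ha n)) η
    exact hm.closure w.continuous
  have hinv' : ∀ w ∈ (center M).commutant, ∀ ξ ∈ ⨆ n, K n, w ξ ∈ ⨆ n, K n := by
    intro w hw
    have : (⨆ n, K n) ≤ (⨆ n, K n).comap (w : H →ₗ[ℂ] H) :=
      iSup_le fun n ξ hξ => Submodule.mem_iSup_of_mem n (hinv w hw n ξ hξ)
    exact this
  have hinvL : ∀ w ∈ (center M).commutant, ∀ ξ ∈ L, w ξ ∈ L := by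
    intro w hw ξ hξ
    rw [Submodule.mem_orthogonal] at hξ ⊢
    intro η hη
    rw [← ContinuousLinearMap.adjoint_inner_left]
    exact hξ _ (hinv' _ (star_mem hw) η hη)
  have horth : ∀ m n, m ≠ n → K m ⟂ K n := by
    intro m n hmn
    refine Submodule.topologicalClosure_minimal _ ?_ (Submodule.isClosed_orthogonal _)
    rw [Submodule.orthogonal_closure]
    rintro _ ⟨ξ, rfl⟩
    rw [Submodule.mem_orthogonal]
    rintro _ ⟨η, rfl⟩
    change inner ℂ (a n η) (a m ξ) = 0
    rw [← ContinuousLinearMap.adjoint_inner_right, ← ContinuousLinearMap.star_eq_adjoint,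
      ← mul_apply_eq_comp, ho n m hmn.symm]
    simp
  have hLK : ∀ n, L ⟂ K n := fun n =>
    (Submodule.isOrtho_orthogonal_left _).mono_right (le_iSup K n)
  -- The complement occupies index `0`; it may vanish, which is why only the later projections are
  -- claimed to be nonzero.
  let z : ℕ → H →L[ℂ] H := fun n => n.casesOn L.starProjection fun n => (K n).starProjection
  refine ⟨z, ?_, ?_, ?_, ?_⟩
  · rintro (_ | n)
    · exact starProjection_mem L hinvL
    · exact starProjection_mem (K n) fun w hw => hinv w hw n
  · intro n hn
    refine h0 n ?_
    ext ξ
    have h1 : (K n).starProjection (a n ξ) = a n ξ :=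
      Submodule.starProjection_eq_self_iff.2 (Submodule.le_topologicalClosure _ ⟨ξ, rfl⟩)
    have h2 : (K n).starProjection = 0 := hn
    rw [← h1, h2]
    rfl
  · rintro (_ | m) (_ | n) hmn
    · exact absurd rfl hmn
    · exact Submodule.starProjection_comp_starProjection_eq_zero_iff.2 (hLK n)
    · exact Submodule.starProjection_comp_starProjection_eq_zero_iff.2 (hLK m).symm
    · exact Submodule.starProjection_comp_starProjection_eq_zero_iff.2 (horth m n (by simpa using hmn))
  -- A vector orthogonal to all the ranges is orthogonal to every `K n`, so it lies in `L`, and it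
  -- is also orthogonal to `L`.
  · rw [HasSupOne, Submodule.topologicalClosure_eq_top_iff, Submodule.eq_bot_iff]
    intro ξ hξ
    have h1 : L ≤ ⨆ n, (z n).range :=
      (Submodule.range_starProjection L).ge.trans (le_iSup (fun n => (z n).range) 0)
    have h2 : (⨆ n, K n) ≤ ⨆ n, (z n).range := iSup_le fun n =>
      (Submodule.range_starProjection (K n)).ge.trans (le_iSup (fun n => (z n).range) (n + 1))
    have h3 : ξ ∈ L := Submodule.orthogonal_le h2 hξ
    exact inner_self_eq_zero.1 (Submodule.mem_orthogonal _ _ |>.1 hξ ξ (h1 h3))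

end Center


/-! ### An unbounded element of the central extension over an infinite-dimensional center. -/

section Unbounded

variable {H : Type u} [NormedAddCommGroup H] [InnerProductSpace ℂ H]

theorem ker_ofBounded_eq_bot {b : H →L[ℂ] H} (hb : Function.Injective b) :
    LinearMap.ker (ofBounded b).toFun = ⊥ := by
  rw [LinearMap.ker_eq_bot]
  intro ξ η h
  exact Subtype.ext (hb h)

theorem mem_graph_inverse {b : H →L[ℂ] H} (hb : Function.Injective b) {ξ η : H} :
    (ξ, η) ∈ (ofBounded b).inverse.graph ↔ b η = ξ := by
  rw [LinearPMap.inverse_graph (ker_ofBounded_eq_bot hb), Submodule.mem_map]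
  constructor
  · rintro ⟨⟨η', ξ'⟩, h, e⟩
    rw [mem_graph_ofBounded] at h
    obtain ⟨rfl, rfl⟩ := Prod.mk.inj e
    exact h
  · rintro rfl
    exact ⟨(η, b η), mem_graph_ofBounded.2 rfl, rfl⟩

/-- On the dense range of `b` the product of `z` with the inverse of `b` agrees with `T`, so the
closure is `T`. -/
theorem strongMul_inverse {b : H →L[ℂ] H} (hb : Function.Injective b)
    (hd : Dense (Set.range b)) {z T : H →L[ℂ] H} (hT : T * b = z) :
    strongMul (ofBounded z) (ofBounded b).inverse = ofBounded T := by
  refine closure_eq_ofBounded ?_ fun ξ => ?_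
  · rw [prod_ofBounded_left_domain]
    refine hd.mono ?_
    rintro _ ⟨η, rfl⟩
    exact LinearPMap.mem_domain_of_mem_graph ((mem_graph_inverse hb).2 rfl)
  · have h := (mem_graph_inverse hb).1
      (LinearPMap.mem_graph _ (⟨ξ, prod_domain_le _ _ ξ.2⟩ : (ofBounded b).inverse.domain))
    dsimp only at h
    rw [prod_ofBounded_left_apply, ← hT, mul_apply_eq_comp, h]

variable [CompleteSpace H]

theorem norm_le_one_of_isStarProjection {e : H →L[ℂ] H} (he : IsStarProjection e) : ‖e‖ ≤ 1 := by
  have h := CStarRing.norm_star_mul_self (x := e)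
  rw [he.isSelfAdjoint.star_eq, he.isIdempotentElem.eq] at h
  nlinarith [norm_nonneg e]

/-- In graph form affiliation carries no domain proofs, and it passes easily to inverses and to
linear combinations of graph points. -/
theorem affiliated_iff_graph {M : VonNeumannAlgebra H} {x : H →ₗ.[ℂ] H} :
    Affiliated M x ↔ ∀ w ∈ M.commutant, w ∈ unitary (H →L[ℂ] H) →
      ∀ ξ η, (ξ, η) ∈ x.graph → (w ξ, w η) ∈ x.graph := by
  refine forall₃_congr fun w _ _ => ⟨fun h ξ η hξ => ?_, fun h ξ => ?_⟩
  · obtain ⟨ζ, h1, h2⟩ := (LinearPMap.mem_graph_iff _).1 hξ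
    dsimp only at h1 h2
    subst h1 h2
    obtain ⟨h3, h4⟩ := h ζ
    rw [h4]
    exact x.mem_graph ⟨_, h3⟩
  · obtain ⟨ζ, h1, h2⟩ := (LinearPMap.mem_graph_iff _).1 (h _ _ (x.mem_graph ξ))
    dsimp only at h1 h2
    refine ⟨h1 ▸ ζ.2, ?_⟩
    rw [← h2]
    congr 1
    exact Subtype.ext h1

/-- Sum of a sequence of projections weighted with the coefficients `2⁻ⁿ`. -/
theorem exists_weighted_sum {M : VonNeumannAlgebra H} {z : ℕ → H →L[ℂ] H}
    (hz : ∀ n, IsProj (center M) (z n)) (ho : ∀ m n, m ≠ n → z m * z n = 0) :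
    ∃ b ∈ center M, ∀ n, z n * b = (1 / 2 : ℂ) ^ n • z n := by
  have hs : Summable fun n => (1 / 2 : ℂ) ^ n • z n := by
    refine Summable.of_norm_bounded (g := fun n => (1 / 2 : ℝ) ^ n) summable_geometric_two ?_
    intro n
    rw [norm_smul, norm_pow]
    have := norm_le_one_of_isStarProjection (hz n).1
    have h2 : ‖(1 / 2 : ℂ)‖ = 1 / 2 := by simp
    rw [h2]
    exact mul_le_of_le_one_right (by positivity) this
  refine ⟨∑' n, (1 / 2 : ℂ) ^ n • z n, ?_, fun n => ?_⟩
  · refine (isClosed_toStarSubalgebra (center M)).mem_of_tendsto hs.hasSum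
      (Filter.Eventually.of_forall fun s => ?_)
    exact sum_mem fun n _ => smul_mem_of_mem _ _ (hz n).2
  · rw [← hs.tsum_mul_left, tsum_eq_single n]
    · rw [mul_smul_comm, (hz n).1.isIdempotentElem.eq]
    · intro m hm
      rw [mul_smul_comm, ho n m hm.symm, smul_zero]

theorem isStarProjection_sum {ι : Type*} {z : ι → H →L[ℂ] H} (s : Finset ι)
    (hz : ∀ i, IsStarProjection (z i)) (ho : ∀ i j, i ≠ j → z i * z j = 0) :
    IsStarProjection (∑ i ∈ s, z i) := by
  constructor
  · rw [IsIdempotentElem, Finset.sum_mul_sum]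
    refine Finset.sum_congr rfl fun i hi => ?_
    rw [Finset.sum_eq_single_of_mem i hi, (hz i).isIdempotentElem.eq]
    intro j _ hj
    exact ho i j hj.symm
  · exact isSelfAdjoint_sum _ fun i _ => (hz i).isSelfAdjoint

theorem isProj_center_sum {M : VonNeumannAlgebra H} {ι : Type*} {z : ι → H →L[ℂ] H} (s : Finset ι)
    (hz : ∀ i, IsProj (center M) (z i)) (ho : ∀ i j, i ≠ j → z i * z j = 0) :
    IsProj (center M) (∑ i ∈ s, z i) :=
  ⟨isStarProjection_sum s (fun i => (hz i).1) ho, sum_mem fun i _ => (hz i).2⟩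

/-- The kernel of a projection is the orthogonal complement of its range, and the ranges span a
dense subspace. -/
theorem eq_zero_of_hasSupOne {ι : Type*} {z : ι → H →L[ℂ] H} (hz : ∀ i, IsStarProjection (z i))
    (h1 : HasSupOne z) {ξ : H} (h : ∀ i, z i ξ = 0) : ξ = 0 := by
  rw [HasSupOne, Submodule.topologicalClosure_eq_top_iff, Submodule.eq_bot_iff] at h1
  refine h1 ξ ?_
  rw [← Submodule.iInf_orthogonal, Submodule.mem_iInf]
  intro i
  rw [Submodule.mem_orthogonal]
  rintro _ ⟨η, rfl⟩
  change inner ℂ (z i η) ξ = 0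
  rw [← ContinuousLinearMap.adjoint_inner_right, ← ContinuousLinearMap.star_eq_adjoint,
    (hz i).isSelfAdjoint.star_eq, h i, inner_zero_right]

/-- If the central extension adds nothing, then the center is finite-dimensional. -/
theorem finiteDimensional_center_of_eq {M : VonNeumannAlgebra H}
    (hE : centralExtension M = boundedOps M) :
    FiniteDimensional ℂ (center M).toStarSubalgebra := by
  by_contra hfd
  obtain ⟨z, hz, hz0, ho, h1⟩ := exists_seq_central_projections M hfd
  obtain ⟨b, hbM, hzb⟩ := exists_weighted_sum hz ho
  have hbz : ∀ n, b * z n = (1 / 2 : ℂ) ^ n • z n := fun n => by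
    rw [← hzb n, (mem_center_iff.1 (hz n).2).2 b (mem_of_mem_center hbM)]
  have h2 : ∀ n, ((2 : ℂ) ^ n) * (1 / 2) ^ n = 1 := fun n => by
    rw [← mul_pow]; norm_num
  have hb : Function.Injective b := by
    rw [injective_iff_map_eq_zero]
    intro ξ hξ
    refine eq_zero_of_hasSupOne (fun n => (hz n).1) h1 fun n => ?_
    have h3 : ((1 / 2 : ℂ) ^ n • z n) ξ = 0 := by
      rw [← hzb n, mul_apply_eq_comp, hξ, map_zero]
    have h4 : ((2 : ℂ) ^ n) • ((1 / 2 : ℂ) ^ n • z n ξ) = 0 := by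
      rw [← smul_apply, h3, smul_zero]
    rwa [smul_smul, h2, one_smul] at h4
  have hrange : ∀ n, (z n).range ≤ b.range := by
    rintro n _ ⟨η, rfl⟩
    refine ⟨(2 : ℂ) ^ n • z n η, ?_⟩
    change b ((2 : ℂ) ^ n • z n η) = z n η
    have := DFunLike.congr_fun (hbz n) η
    rw [mul_apply_eq_comp] at this
    rw [map_smul, this, smul_apply, smul_smul, h2, one_smul]
  have hd : Dense (Set.range b) := by
    have h3 : b.range.topologicalClosure = ⊤ := by
      refine top_unique (h1.ge.trans (Submodule.topologicalClosure_mono (iSup_le hrange)))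
    rw [← Submodule.dense_iff_topologicalClosure_eq_top] at h3
    exact h3
  -- Since `b` acts as $2^{-n}$ on the range of `z n`, its inverse `x` acts there as $2^n$.
  set x := (ofBounded b).inverse with hx
  have hmul : ∀ s : Finset ℕ, strongMul (ofBounded (∑ n ∈ s, z n)) x =
      ofBounded (∑ n ∈ s, (2 : ℂ) ^ n • z n) := by
    intro s
    refine strongMul_inverse hb hd ?_
    rw [Finset.sum_mul]
    refine Finset.sum_congr rfl fun n _ => ?_
    rw [smul_mul_assoc, hzb, smul_smul, h2, one_smul]
  have hmem : ∀ s : Finset ℕ, ∑ n ∈ s, (2 : ℂ) ^ n • z n ∈ M := fun s =>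
    sum_mem fun n _ => smul_mem_of_mem _ _ (mem_of_mem_center (hz n).2)
  have hxE : x ∈ centralExtension M := by
    -- Partial sums of the `z k` witness local measurability; the `z k` themselves are the
    -- orthogonal family for the central extension.
    refine ⟨⟨?_, ?_, fun n => ∑ k ∈ Finset.range n, z k, fun n => isProj_center_sum _ hz ho,
      ⟨?_, ?_⟩, fun n => ?_⟩, Set.range z, ?_, ?_, ?_, ?_⟩
    · exact (LinearPMap.inverse_closed_iff (ker_ofBounded_eq_bot hb)).2 (ofBounded_isClosed b)
    · rw [affiliated_iff_graph]
      intro w hw _ ξ η h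
      rw [mem_graph_inverse hb] at h ⊢
      rw [← h]
      exact DFunLike.congr_fun (VonNeumannAlgebra.mem_commutant_iff.1 hw b (mem_of_mem_center hbM)) η
    · refine monotone_nat_of_le_succ fun n => ?_
      rw [Finset.sum_range_succ]
      exact le_add_of_nonneg_right (hz n).1.nonneg
    · refine top_unique (h1.ge.trans (Submodule.topologicalClosure_mono (iSup_le fun n => ?_)))
      refine le_trans ?_ (le_iSup (fun n => (∑ k ∈ Finset.range n, z k).range) (n + 1))
      rintro _ ⟨η, rfl⟩
      refine ⟨z n η, ?_⟩
      change (∑ k ∈ Finset.range (n + 1), z k) (z n η) = z n η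
      rw [← mul_apply_eq_comp, Finset.sum_mul, Finset.sum_eq_single_of_mem n (by simp),
        (hz n).1.isIdempotentElem.eq]
      exact fun k _ hk => ho k n hk
    · rw [hmul]
      exact ofBounded_mem_measurableOps (hmem _)
    · rintro _ ⟨n, rfl⟩
      exact hz n
    · rintro _ ⟨m, rfl⟩ _ ⟨n, rfl⟩ hmn
      exact ho m n fun h => hmn (h ▸ rfl)
    · refine top_unique (h1.ge.trans (Submodule.topologicalClosure_mono (iSup_le fun n => ?_)))
      exact le_iSup (fun y : Set.range z => (y : H →L[ℂ] H).range) ⟨z n, n, rfl⟩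
    · rintro _ ⟨n, rfl⟩
      have := hmul {n}
      have hm := hmem {n}
      rw [Finset.sum_singleton, Finset.sum_singleton] at this
      rw [Finset.sum_singleton] at hm
      rw [this]
      exact ⟨_, hm, rfl⟩
  rw [hE] at hxE
  obtain ⟨y, -, hy⟩ := hxE
  have hyb : ∀ η, y (b η) = η := by
    intro η
    have := (mem_graph_inverse hb (ξ := b η) (η := η)).2 rfl
    rwa [← hx, ← hy, mem_graph_ofBounded] at this
  -- A bounded left inverse `y` of `b` multiplies by $2^{n+1}$ on the nonzero range of `z (n + 1)`;
  -- index `0` is skipped because `z 0` may be zero.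
  have hn : ∀ n : ℕ, (2 : ℝ) ^ (n + 1) ≤ ‖y‖ := by
    intro n
    have h3 : z (n + 1) = (1 / 2 : ℂ) ^ (n + 1) • (y * z (n + 1)) := by
      rw [← mul_smul_comm, ← hbz]
      ext η
      exact (hyb _).symm
    have h4 : (2 : ℝ) ^ (n + 1) * ‖z (n + 1)‖ ≤ ‖y‖ * ‖z (n + 1)‖ := by
      have h5 : ((2 : ℂ) ^ (n + 1)) • z (n + 1) = y * z (n + 1) := by
        conv_lhs => rw [h3]
        rw [smul_smul, h2, one_smul]
      have h6 := norm_mul_le y (z (n + 1))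
      rw [← h5, norm_smul, norm_pow] at h6
      simpa using h6
    exact le_of_mul_le_mul_right h4 (norm_pos_iff.2 (hz0 n))
  obtain ⟨n, hn'⟩ := pow_unbounded_of_one_lt ‖y‖ (one_lt_two)
  have := hn n
  rw [pow_succ] at this
  have h0 : (0 : ℝ) < 2 ^ n := by positivity
  linarith

end Unbounded

/-! ### Boundedness of the central extension over a finite-dimensional center. -/

section Converse

variable {H : Type u} [NormedAddCommGroup H] [InnerProductSpace ℂ H] [CompleteSpace H]

/-- If `z x` is bounded for a central projection `z`, then `x` is bounded on the range of `z`. -/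
theorem mem_graph_of_strongMul {M : VonNeumannAlgebra H} {x : H →ₗ.[ℂ] H} (hc : x.IsClosed)
    (ha : Affiliated M x) {z y : H →L[ℂ] H} (hz : IsProj (center M) z)
    (hy : strongMul (ofBounded z) x = ofBounded y) (ξ : H) : (z ξ, y ξ) ∈ x.graph := by
  have hidem : z * z = z := hz.1.isIdempotentElem.eq
  -- Affiliation speaks only of unitaries of the commutant. The symmetry `2 • z - 1` is one of them,
  -- and averaging it with the identity shows that `z` preserves the graph of `x`.
  have hu : 2 • z - 1 ∈ unitary (H →L[ℂ] H) := by
    have h1 : star (2 • z - 1) = 2 • z - 1 := by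
      rw [star_sub, star_smul, hz.1.isSelfAdjoint.star_eq, star_one]
      simp
    have h2 : (2 • z - 1) * (2 • z - 1) = 1 := by
      have : (2 • z - 1) * (2 • z - 1) = 4 • (z * z) - 4 • z + 1 := by noncomm_ring
      rw [this, hidem]
      simp
    exact Unitary.mem_iff.2 ⟨by rw [h1, h2], by rw [h1, h2]⟩
  have hzc : z ∈ M.commutant := hz.2.2
  have hw : 2 • z - 1 ∈ M.commutant := sub_mem (nsmul_mem hzc 2) (one_mem _)
  have hgz : ∀ ξ η, (ξ, η) ∈ x.graph → (z ξ, z η) ∈ x.graph := by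
    intro ξ η h
    have h1 := affiliated_iff_graph.1 ha _ hw hu ξ η h
    have h2 := x.graph.smul_mem (1 / 2 : ℂ) (x.graph.add_mem h h1)
    convert h2 using 1
    simp only [Prod.mk_add_mk, Prod.smul_mk, sub_apply, two_smul,
      add_apply, one_apply_eq_self]
    congr 1 <;> module
  have hgp : (prod (ofBounded z) x).graph ≤ x.graph.comap
      ((z : H →ₗ[ℂ] H).prodMap LinearMap.id) := by
    rintro ⟨ζ, η⟩ h
    obtain ⟨ξ', h1, h2⟩ := (LinearPMap.mem_graph_iff _).1 h
    dsimp only at h1 h2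
    subst h1 h2
    exact hgz _ _ (x.mem_graph ⟨ξ', prod_domain_le _ _ ξ'.2⟩)
  -- The closure of a non-closable operator is by convention the operator itself; in both cases the
  -- graph of `y` lies in the closed graph of the product.
  have hmem : (ξ, y ξ) ∈ (prod (ofBounded z) x).graph.topologicalClosure := by
    by_cases hcl : (prod (ofBounded z) x).IsClosable
    · rw [hcl.graph_closure_eq_closure_graph]
      change (ξ, y ξ) ∈ (strongMul (ofBounded z) x).graph
      rw [hy, mem_graph_ofBounded]
    · rw [strongMul, LinearPMap.closure_def' hcl] at hy
      refine Submodule.le_topologicalClosure _ ?_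
      rw [hy, mem_graph_ofBounded]
  have hclosed : IsClosed ((x.graph.comap ((z : H →ₗ[ℂ] H).prodMap LinearMap.id) :
      Submodule ℂ (H × H)) : Set (H × H)) := by
    have : Continuous fun p : H × H => (z p.1, p.2) := by fun_prop
    exact IsClosed.preimage this hc
  exact Submodule.topologicalClosure_minimal _ hgp hclosed hmem

theorem sum_eq_one_of_hasSupOne {ι : Type*} [Fintype ι] {z : ι → H →L[ℂ] H}
    (hz : ∀ i, IsStarProjection (z i)) (ho : ∀ i j, i ≠ j → z i * z j = 0) (h1 : HasSupOne z) :
    ∑ i, z i = 1 := by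
  ext ξ
  rw [← sub_eq_zero]
  refine eq_zero_of_hasSupOne hz h1 fun i => ?_
  rw [map_sub, ← mul_apply_eq_comp, Finset.mul_sum, Finset.sum_eq_single i,
    (hz i).isIdempotentElem.eq]
  · simp
  · exact fun j _ hj => ho i j hj.symm
  · simp

/-- If the center is finite-dimensional, then the central extension adds nothing. -/
theorem centralExtension_eq_of_finiteDimensional {M : VonNeumannAlgebra H}
    (h : FiniteDimensional ℂ (center M).toStarSubalgebra) :
    centralExtension M = boundedOps M := by
  refine Set.Subset.antisymm ?_ (boundedOps_subset_centralExtension M)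
  rintro x ⟨⟨hc, ha, -⟩, Z, hZ, ho, h1, hb⟩
  have := (finite_of_orthogonal_center h hZ ho).fintype
  choose y hyM hy using fun z : Z => hb z z.2
  have hsum : ∑ z : Z, (z : H →L[ℂ] H) = 1 :=
    sum_eq_one_of_hasSupOne (fun z => (hZ z z.2).1)
      (fun z w hzw => ho z z.2 w w.2 fun h => hzw (Subtype.ext h)) h1
  -- Adding the finitely many graph points `(z ξ, y z ξ)` shows that `x` is everywhere defined.
  have hg : ∀ ξ, (ξ, (∑ z, y z) ξ) ∈ x.graph := by
    intro ξ
    have h2 := x.graph.sum_mem (t := Finset.univ) fun (z : Z) _ =>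
      mem_graph_of_strongMul hc ha (hZ z z.2) (hy z).symm ξ
    convert h2 using 1
    rw [Prod.ext_iff, Prod.fst_sum, Prod.snd_sum]
    refine ⟨?_, by simp⟩
    rw [← sum_apply, hsum, one_apply_eq_self]
  refine ⟨∑ z, y z, sum_mem fun z _ => hyM z, ?_⟩
  refine LinearPMap.eq_of_le_of_domain_eq (LinearPMap.le_of_le_graph ?_) ?_
  · rintro ⟨ξ, η⟩ hξ
    rw [mem_graph_ofBounded] at hξ
    dsimp only at hξ
    rw [← hξ]
    exact hg ξ
  · exact (top_unique fun ξ _ => LinearPMap.mem_domain_of_mem_graph (hg ξ)).symm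

end Converse


/-! ### Corners, and decomposition into factors. -/

section DirectSum

variable {H : Type u} [NormedAddCommGroup H] [InnerProductSpace ℂ H]

/-- A projection, with codomain restricted to its range. -/
def toRange (e : H →L[ℂ] H) : H →L[ℂ] e.range :=
  e.codRestrict e.range fun ξ => ⟨ξ, rfl⟩

/-- An operator on the range of a projection, extended by zero. -/
def extendRange (e : H →L[ℂ] H) (y : e.range →L[ℂ] e.range) : H →L[ℂ] H :=
  e.range.subtypeL ∘L y ∘L toRange e

@[simp]
theorem coe_toRange (e : H →L[ℂ] H) (ξ : H) : (toRange e ξ : H) = e ξ := rfl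

theorem extendRange_apply (e : H →L[ℂ] H) (y : e.range →L[ℂ] e.range) (ξ : H) :
    extendRange e y ξ = y (toRange e ξ) := rfl

theorem extendRange_one (e : H →L[ℂ] H) : extendRange e 1 = e := rfl

/-- The compression of an operator to the range of a projection. -/
def compress (e x : H →L[ℂ] H) : e.range →L[ℂ] e.range :=
  toRange e ∘L x ∘L e.range.subtypeL

theorem extendRange_compress (e x : H →L[ℂ] H) : extendRange e (compress e x) = e * x * e := rfl

/-- The diagonal operator with given components, in a Hilbert space identified with a sum. -/
theorem exists_diagonal {n : ℕ} {K : Fin n → Type u} [∀ k, NormedAddCommGroup (K k)]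
    [∀ k, InnerProductSpace ℂ (K k)] (U : H ≃ₗᵢ[ℂ] PiLp 2 K) (y : ∀ k, K k →L[ℂ] K k) :
    ∃ x : H →L[ℂ] H, ∀ ξ k, U (x ξ) k = y k (U ξ k) := by
  refine ⟨(U.symm.toContinuousLinearEquiv : PiLp 2 K →L[ℂ] H) ∘L
    ((PiLp.continuousLinearEquiv 2 ℂ K).symm : (∀ k, K k) →L[ℂ] PiLp 2 K) ∘L
    (ContinuousLinearMap.pi fun k => y k ∘L ContinuousLinearMap.proj k) ∘L
    (PiLp.continuousLinearEquiv 2 ℂ K : PiLp 2 K →L[ℂ] ∀ k, K k) ∘L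
    (U.toContinuousLinearEquiv : H →L[ℂ] PiLp 2 K), fun ξ k => ?_⟩
  simp

variable [CompleteSpace H]

theorem completeSpace_range {e : H →L[ℂ] H} (he : IsStarProjection e) : CompleteSpace e.range := by
  have : IsClosed (e.range : Set H) :=
    ContinuousLinearMap.IsIdempotentElem.isClosed_range he.isIdempotentElem
  exact this.completeSpace_coe

theorem apply_of_mem_range {e : H →L[ℂ] H} (he : IsStarProjection e) (ξ : e.range) :
    e ξ = ξ := by
  obtain ⟨_, η, rfl⟩ := ξ
  exact DFunLike.congr_fun he.isIdempotentElem.eq η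

theorem toRange_coe {e : H →L[ℂ] H} (he : IsStarProjection e) (ξ : e.range) :
    toRange e ξ = ξ := Subtype.ext (apply_of_mem_range he ξ)

theorem extendRange_mul {e : H →L[ℂ] H} (he : IsStarProjection e) (x y : e.range →L[ℂ] e.range) :
    extendRange e (x * y) = extendRange e x * extendRange e y := by
  ext ξ
  rw [mul_apply_eq_comp, extendRange_apply, extendRange_apply, extendRange_apply,
    toRange_coe he, mul_apply_eq_comp]

theorem extendRange_star {e : H →L[ℂ] H} (he : IsStarProjection e) [CompleteSpace e.range]
    (y : e.range →L[ℂ] e.range) : extendRange e (star y) = star (extendRange e y) := by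
  -- For a self-adjoint `e`, the map `toRange e` is the adjoint of the inclusion of its range.
  have h : ∀ (ξ : H) (η : e.range), inner ℂ (toRange e ξ) η = inner ℂ ξ (η : H) := by
    intro ξ η
    rw [Submodule.coe_inner, coe_toRange]
    conv_rhs => rw [← apply_of_mem_range he η, ← ContinuousLinearMap.adjoint_inner_left,
      ← ContinuousLinearMap.star_eq_adjoint, he.isSelfAdjoint.star_eq]
  rw [ContinuousLinearMap.star_eq_adjoint, ContinuousLinearMap.star_eq_adjoint,
    ContinuousLinearMap.eq_adjoint_iff]
  intro ξ η
  rw [extendRange_apply, extendRange_apply, ← h, ← inner_conj_symm, ← h, inner_conj_symm,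
    ContinuousLinearMap.adjoint_inner_left]

theorem extendRange_injective {e : H →L[ℂ] H} (he : IsStarProjection e) :
    Function.Injective (extendRange e) := by
  intro x y h
  ext ξ
  have := DFunLike.congr_fun h (ξ : H)
  rwa [extendRange_apply, extendRange_apply, toRange_coe he] at this

theorem extendRange_mul_left {e : H →L[ℂ] H} (he : IsStarProjection e)
    (y : e.range →L[ℂ] e.range) : e * extendRange e y = extendRange e y := by
  have := extendRange_mul he 1 y
  rwa [one_mul, extendRange_one, eq_comm] at this

theorem extendRange_mul_right {e : H →L[ℂ] H} (he : IsStarProjection e)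
    (y : e.range →L[ℂ] e.range) : extendRange e y * e = extendRange e y := by
  have := extendRange_mul he y 1
  rwa [mul_one, extendRange_one, eq_comm] at this

/-- The corner `e M e`, acting on the range of the projection `e ∈ M`. -/
theorem exists_corner {M : VonNeumannAlgebra H} {e : H →L[ℂ] H} (he : IsProj M e)
    [CompleteSpace e.range] :
    ∃ N : VonNeumannAlgebra e.range, ∀ y, y ∈ N ↔ extendRange e y ∈ M := by
  let S : StarSubalgebra ℂ (e.range →L[ℂ] e.range) :=
    { carrier := {y | extendRange e y ∈ M}
      mul_mem' := fun {x y} hx hy => by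
        rw [Set.mem_ofPred_eq, extendRange_mul he.1]
        exact mul_mem hx hy
      add_mem' := fun {x y} hx hy => by
        have : extendRange e (x + y) = extendRange e x + extendRange e y := rfl
        rw [Set.mem_ofPred_eq, this]
        exact add_mem hx hy
      algebraMap_mem' := fun c => by
        have : extendRange e (algebraMap ℂ _ c) = c • e := rfl
        rw [Set.mem_ofPred_eq, this]
        exact smul_mem_of_mem M c he.2
      star_mem' := fun {x} hx => by
        change extendRange e (star x) ∈ M
        rw [extendRange_star he.1]
        exact star_mem hx }
  refine ⟨⟨S, ?_⟩, fun y => Iff.rfl⟩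
  refine Set.Subset.antisymm (fun y hy => ?_) Set.subset_centralizer_centralizer
  refine mem_of_commute fun t ht => ?_
  have hte : e * t = t * e := VonNeumannAlgebra.mem_commutant_iff.1 ht e he.2
  -- Elements `t` of the commutant of `M` commute with `e`, and their compressions commute with the
  -- corner. An element `y` of the bicommutant of the corner thus commutes with these compressions,
  -- so its extension by zero commutes with every `t`.
  have hc : compress e t ∈ Set.centralizer S.carrier := by
    intro x hx
    have hxt := VonNeumannAlgebra.mem_commutant_iff.1 ht _ hx
    refine extendRange_injective he.1 ?_
    rw [extendRange_mul he.1, extendRange_mul he.1, extendRange_compress, hte, mul_assoc t,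
      he.1.isIdempotentElem.eq, ← mul_assoc, hxt, mul_assoc, mul_assoc,
      extendRange_mul_left he.1, extendRange_mul_right he.1]
  have h1 := congrArg (extendRange e) (hy _ hc)
  rw [extendRange_mul he.1, extendRange_mul he.1, extendRange_compress] at h1
  have h2 : e * t * e = t * e := by rw [hte, mul_assoc, he.1.isIdempotentElem.eq]
  rw [h2, mul_assoc, extendRange_mul_left he.1, ← hte, ← mul_assoc,
    extendRange_mul_right he.1] at h1
  exact h1

/-- If the center is finite-dimensional, then the algebra is a finite direct sum of factors. -/
theorem isFiniteDirectSumOfFactors_of_finiteDimensional {M : VonNeumannAlgebra H}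
    (h : FiniteDimensional ℂ (center M).toStarSubalgebra) : IsFiniteDirectSumOfFactors M := by
  obtain ⟨n, e, he, -, ho, hsum, hspan⟩ := exists_minimal_central_projections M h
  have hcs : ∀ k, CompleteSpace (e k).range := fun k => completeSpace_range (he k).1
  choose N hN using fun k => exists_corner (isProj_center_left (he k))
  have hof : OrthogonalFamily ℂ (fun k => (e k).range) fun k => (e k).range.subtypeₗᵢ := by
    rintro i j hij ⟨_, ξ, rfl⟩ ⟨_, η, rfl⟩
    change inner ℂ (e i ξ) (e j η) = 0
    rw [← ContinuousLinearMap.adjoint_inner_right, ← ContinuousLinearMap.star_eq_adjoint,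
      (he i).1.isSelfAdjoint.star_eq, ← mul_apply_eq_comp, ho i j hij]
    simp
  have hsum' : ∀ ξ, ∑ k, e k ξ = ξ := fun ξ => by
    rw [← sum_apply, hsum, one_apply_eq_self]
  have htop : (⨆ k, (e k).range) = ⊤ := by
    refine top_unique fun ξ _ => ?_
    rw [← hsum' ξ]
    exact sum_mem fun k _ => Submodule.mem_iSup_of_mem k ⟨ξ, rfl⟩
  have hint : DirectSum.IsInternal fun k => (e k).range := by
    rw [hof.isInternal_iff_of_isComplete, htop, Submodule.top_orthogonal_eq_bot]
    rw [htop]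
    exact isComplete_univ
  let U := hint.isometryL2OfOrthogonalFamily hof
  have hU : ∀ ξ k, U ξ k = toRange (e k) ξ := by
    intro ξ k
    have : U ξ = WithLp.toLp 2 fun k => toRange (e k) ξ := by
      rw [← U.symm.injective.eq_iff, U.symm_apply_apply,
        hint.isometryL2OfOrthogonalFamily_symm_apply hof]
      exact (hsum' ξ).symm
    rw [this]
  refine ⟨n, fun k => (e k).range, fun k => inferInstance, fun k => inferInstance, hcs, N, U,
    fun k x hx => ?_, fun x => ⟨fun hx => ?_, ?_⟩⟩
  · obtain ⟨hxN, hxc⟩ := mem_center_iff.1 hx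
    -- As `e k` is central, `m * e k` comes from the corner for every `m ∈ M`; hence the center of
    -- the corner lies in the center of `M`, where `hspan` leaves only multiples of `e k`.
    have hxZ : extendRange (e k) x ∈ center M := by
      refine mem_center_iff.2 ⟨(hN k x).1 hxN, fun m hm => ?_⟩
      have hek := (mem_center_iff.1 (he k).2).2 m hm
      have hm' : extendRange (e k) (compress (e k) m) = m * e k := by
        rw [extendRange_compress, ← hek, mul_assoc, (he k).1.isIdempotentElem.eq]
      have h1 := hxc (compress (e k) m) (by
        rw [hN, hm']
        exact mul_mem hm (mem_of_mem_center (he k).2))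
      have h2 := congrArg (extendRange (e k)) h1
      rwa [extendRange_mul (he k).1, extendRange_mul (he k).1, hm', mul_assoc,
        extendRange_mul_left (he k).1, hek, ← mul_assoc, extendRange_mul_right (he k).1] at h2
    obtain ⟨c, hc⟩ := hspan _ hxZ
    refine ⟨c k, extendRange_injective (he k).1 ?_⟩
    have h3 : extendRange (e k) (c k • 1) = c k • e k := rfl
    rw [h3, ← extendRange_mul_left (he k).1 x, hc, Finset.mul_sum, Finset.sum_eq_single k,
      mul_smul_comm, (he k).1.isIdempotentElem.eq]
    · intro j _ hj
      rw [mul_smul_comm, ho k j hj.symm, smul_zero]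
    · simp
  · have hek := fun k => (mem_center_iff.1 (he k).2).2 x hx
    refine ⟨fun k => compress (e k) x, fun k => ?_, fun ξ k => ?_⟩
    · rw [hN, extendRange_compress]
      exact mul_mem (mul_mem (mem_of_mem_center (he k).2) hx) (mem_of_mem_center (he k).2)
    · rw [hU, hU]
      refine Subtype.ext ?_
      change (e k * x) ξ = (e k * (x * e k)) ξ
      rw [hek, ← mul_assoc, (he k).1.isIdempotentElem.eq]
  · rintro ⟨y, hy, hxy⟩
    have : x = ∑ k, extendRange (e k) (y k) := by
      ext ξ
      rw [sum_apply, ← hsum' (x ξ)]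
      refine Finset.sum_congr rfl fun k _ => ?_
      have h4 := congrArg Subtype.val (hxy ξ k)
      rw [hU, hU] at h4
      exact h4
    rw [this]
    exact sum_mem fun k _ => (hN k _).1 (hy k)

/-- The center of a finite direct sum of factors is finite-dimensional. -/
theorem finiteDimensional_of_isFiniteDirectSumOfFactors {M : VonNeumannAlgebra H}
    (h : IsFiniteDirectSumOfFactors M) :
    FiniteDimensional ℂ (center M).toStarSubalgebra := by
  classical
  obtain ⟨n, K, _, _, _, N, U, hN, hM⟩ := h
  choose D hD using exists_diagonal U
  have hDM : ∀ y : ∀ k, K k →L[ℂ] K k, (∀ k, y k ∈ N k) → D y ∈ M := fun y hy =>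
    (hM _).2 ⟨y, hy, hD y⟩
  let P : Fin n → H →L[ℂ] H := fun k => D (Pi.single k 1)
  have hspan : ∀ x ∈ center M, x ∈ Submodule.span ℂ (Set.range P) := by
    intro x hx
    obtain ⟨hxM, hxc⟩ := mem_center_iff.1 hx
    obtain ⟨y, hy, hxy⟩ := (hM x).1 hxM
    have hc : ∀ k, ∃ c : ℂ, y k = c • 1 := by
      intro k
      -- Testing `x` against the diagonal operator with the single entry `m` in position `k` shows
      -- that `y k` commutes with `m`.
      refine hN k _ (mem_center_iff.2 ⟨hy k, fun m hm => ?_⟩)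
      have hmN : ∀ j, (Pi.single k m : ∀ j, K j →L[ℂ] K j) j ∈ N j := by
        intro j
        obtain rfl | hj := eq_or_ne j k
        · simpa using hm
        · rw [Pi.single_eq_of_ne hj]
          exact zero_mem _
      have h1 := hxc _ (hDM _ hmN)
      ext v
      have h2 := congrArg (fun z : H →L[ℂ] H => U (z (U.symm (WithLp.toLp 2 (Pi.single k v)))) k) h1
      simpa [hD, hxy] using h2
    choose c hc using hc
    have hx' : x = ∑ k, c k • P k := by
      ext ξ
      apply U.injective
      ext k
      rw [hxy, hc, sum_apply, map_sum, WithLp.ofLp_sum, Finset.sum_apply, Finset.sum_eq_single k]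
      · simp [P, hD]
      · intro j _ hj
        simp [P, hD, Pi.single_eq_of_ne hj.symm]
      · simp
    rw [hx']
    exact sum_mem fun k _ => Submodule.smul_mem _ _ (Submodule.subset_span ⟨k, rfl⟩)
  have hfin : FiniteDimensional ℂ (Submodule.span ℂ (Set.range P)) :=
    FiniteDimensional.span_of_finite ℂ (Set.finite_range P)
  let φ : (center M).toStarSubalgebra →ₗ[ℂ] Submodule.span ℂ (Set.range P) :=
    ((center M).toStarSubalgebra.subtype.toAlgHom.toLinearMap).codRestrict _
      fun x => hspan x x.2
  exact FiniteDimensional.of_injective φ fun x y hxy =>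
    Subtype.ext (congrArg (fun s : Submodule.span ℂ (Set.range P) => (s : H →L[ℂ] H)) hxy)

end DirectSum


/-! ### The vector norm over a finite-dimensional center. -/

section VectorNorm

variable {H : Type u} [NormedAddCommGroup H] [InnerProductSpace ℂ H] [CompleteSpace H]

/-- A positive `b` is the square root of its square, and the functional calculus preserves
commutation. -/
theorem commute_of_commute_mul_self {b e : H →L[ℂ] H} (hb : 0 ≤ b) (h : Commute (b * b) e) :
    Commute b e := by
  have h1 : CFC.sqrt (b * b) = b := CFC.sqrt_mul_self b hb
  rw [← h1]
  exact h.cfcₙ_nnreal _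

theorem norm_eq_of_mul_self_eq {b w : H →L[ℂ] H} (hb : 0 ≤ b) (h : b * b = star w * w) :
    ‖b‖ = ‖w‖ := by
  have h1 := CStarRing.norm_star_mul_self (x := b)
  rw [(IsSelfAdjoint.of_nonneg hb).star_eq, h, CStarRing.norm_star_mul_self] at h1
  exact (mul_self_inj (norm_nonneg _) (norm_nonneg _)).1 h1.symm

theorem smul_nonneg_of_isStarProjection {e : H →L[ℂ] H} (he : IsStarProjection e) {r : ℝ}
    (hr : 0 ≤ r) : 0 ≤ (r : ℂ) • e := by
  rw [ContinuousLinearMap.nonneg_iff_isPositive]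
  exact ((ContinuousLinearMap.nonneg_iff_isPositive _).1 he.nonneg).smul_of_nonneg
    (Complex.zero_le_real.2 hr)

open scoped ComplexOrder in
/-- A positive multiple of a nonzero projection has a nonnegative coefficient. -/
theorem norm_eq_of_smul_nonneg {e : H →L[ℂ] H} (he : IsStarProjection e) (h0 : e ≠ 0) {c : ℂ}
    (h : 0 ≤ c • e) : (‖c‖ : ℂ) = c := by
  obtain ⟨ξ, hξ⟩ : ∃ ξ, e ξ ≠ 0 := by
    by_contra! hc
    exact h0 (ContinuousLinearMap.ext hc)
  have hee : e (e ξ) = e ξ := DFunLike.congr_fun he.isIdempotentElem.eq ξ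
  -- Evaluated at a nonzero vector of the range, positivity says that $c\,\|e\xi\|^2 \ge 0$.
  have h1 := ((ContinuousLinearMap.nonneg_iff_isPositive _).1 h).inner_nonneg_right (e ξ)
  rw [smul_apply, hee, inner_smul_right, inner_self_eq_norm_sq_to_K] at h1
  have h3 : (‖e ξ‖ : ℂ) ≠ 0 := by exact_mod_cast norm_ne_zero_iff.2 hξ
  have h2 := mul_nonneg h1 (Complex.zero_le_real.2 (inv_nonneg.2 (sq_nonneg ‖e ξ‖)))
  have h4 : c * (‖e ξ‖ : ℂ) ^ 2 * (((‖e ξ‖ ^ 2)⁻¹ : ℝ) : ℂ) = c := by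
    push_cast
    field_simp
  change 0 ≤ c * (‖e ξ‖ : ℂ) ^ 2 * (((‖e ξ‖ ^ 2)⁻¹ : ℝ) : ℂ) at h2
  rw [h4] at h2
  exact (Complex.eq_coe_norm_of_nonneg h2).symm

/-- A positive operator commuting with orthogonal projections `e i` of sum `1` is dominated by
`∑ i, ‖e i * a * e i‖ • e i`. -/
theorem le_central_sum {n : ℕ} {e : Fin n → H →L[ℂ] H} (he : ∀ i, IsStarProjection (e i))
    (hsum : ∑ i, e i = 1) {a : H →L[ℂ] H} (ha : 0 ≤ a)
    (hc : ∀ i, Commute a (e i)) : a ≤ ∑ i, (‖e i * a * e i‖ : ℂ) • e i := by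
  have h1 : a = ∑ i, e i * a * e i := by
    conv_lhs => rw [← mul_one a, ← hsum, Finset.mul_sum]
    refine Finset.sum_congr rfl fun i _ => ?_
    rw [← (hc i).eq, mul_assoc, (he i).isIdempotentElem.eq]
  conv_lhs => rw [h1]
  refine Finset.sum_le_sum fun i _ => ?_
  have hs : IsSelfAdjoint (e i * a * e i) := by
    have := (IsSelfAdjoint.of_nonneg ha).conjugate (e i)
    rwa [(he i).isSelfAdjoint.star_eq] at this
  -- Conjugation by `e i` turns the bound $T \le \|T\|\,1$ into $T \le \|T\|\,e_i$ for $T = e_i a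
  -- e_i$.
  have h2 := star_left_conjugate_le_conjugate hs.le_algebraMap_norm_self (e i)
  have hi : e i * (e i * a * e i) * e i = e i * a * e i := by
    rw [mul_assoc (e i) a, ← mul_assoc (e i) (e i), (he i).isIdempotentElem.eq, mul_assoc, mul_assoc,
      (he i).isIdempotentElem.eq]
  rw [(he i).isSelfAdjoint.star_eq, hi] at h2
  have h3 : e i * algebraMap ℝ (H →L[ℂ] H) ‖e i * a * e i‖ * e i =
      (‖e i * a * e i‖ : ℂ) • e i := by
    rw [Algebra.algebraMap_eq_smul_one, mul_smul_comm, mul_one, smul_mul_assoc,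
      (he i).isIdempotentElem.eq]
    exact (Complex.coe_smul _ _).symm
  rwa [h3] at h2

/-- `∑ i, ‖e i * a * e i‖ • e i` is below every combination of the `e i` which dominates `a`. -/
theorem central_sum_le {n : ℕ} {e : Fin n → H →L[ℂ] H} (he : ∀ i, IsStarProjection (e i))
    (h0 : ∀ i, e i ≠ 0) (ho : ∀ i j, i ≠ j → e i * e j = 0) {a : H →L[ℂ] H} (ha : 0 ≤ a)
    {d : Fin n → ℂ} (hd : a ≤ ∑ i, d i • e i) :
    ∑ i, (‖e i * a * e i‖ : ℂ) • e i ≤ ∑ i, d i • e i := by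
  refine Finset.sum_le_sum fun i _ => ?_
  have h1 := star_left_conjugate_le_conjugate hd (e i)
  have h2 := star_left_conjugate_nonneg ha (e i)
  have h3 : e i * (∑ j, d j • e j) * e i = d i • e i := by
    rw [Finset.mul_sum, Finset.sum_eq_single i, mul_smul_comm, (he i).isIdempotentElem.eq,
      smul_mul_assoc, (he i).isIdempotentElem.eq]
    · intro j _ hj
      rw [mul_smul_comm, ho i j hj.symm, smul_zero]
    · simp
  rw [(he i).isSelfAdjoint.star_eq] at h2
  rw [(he i).isSelfAdjoint.star_eq, h3] at h1
  -- The coefficients `d i` are complex a priori; domination of a positive operator makes them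
  -- nonnegative, so comparing norms is enough.
  have h4 := norm_eq_of_smul_nonneg (he i) (h0 i) (h2.trans h1)
  have h5 : ‖e i * a * e i‖ ≤ ‖d i‖ := by
    refine (CStarAlgebra.norm_le_norm_of_nonneg_of_le h2 h1).trans ?_
    rw [norm_smul]
    exact mul_le_of_le_one_right (norm_nonneg _) (norm_le_one_of_isStarProjection (he i))
  rw [← h4, ← sub_nonneg, ← sub_smul, ← Complex.ofReal_sub]
  exact smul_nonneg_of_isStarProjection (he i) (sub_nonneg.2 h5)

/-- If the center is finite-dimensional, then every operator measurable with respect to it is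
bounded. -/
theorem exists_eq_ofBounded_of_measurable_center {M : VonNeumannAlgebra H}
    (h : FiniteDimensional ℂ (center M).toStarSubalgebra) {x : H →ₗ.[ℂ] H}
    (hx : x ∈ measurableOps (center M)) : ∃ y ∈ center M, x = ofBounded y := by
  obtain ⟨n, e, he, -, ho, hsum, hspan⟩ := exists_minimal_central_projections M h
  obtain ⟨hc, ha, -, p, hp, ⟨-, h1⟩, hpd⟩ := hx
  -- Each `p m` is a combination of the `e k`, hence a scalar on the range of `e k`. As the `p m`
  -- have supremum `1`, some such scalar is nonzero, and then the range of `e k` lies in that of `p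
  -- m`, which is inside the domain.
  have hle : ∀ k, (e k).range ≤ x.domain := by
    intro k
    choose c hc using fun m => hspan (p m) (hp m).2
    have hpe : ∀ m, p m * e k = c m k • e k := by
      intro m
      conv_lhs => rw [hc m]
      rw [Finset.sum_mul, Finset.sum_eq_single k, smul_mul_assoc, (he k).1.isIdempotentElem.eq]
      · intro j _ hj
        rw [smul_mul_assoc, ho j k hj, smul_zero]
      · simp
    rintro _ ⟨ξ, rfl⟩
    by_cases hk : ∀ m, c m k = 0
    · have : e k ξ = 0 := eq_zero_of_hasSupOne (fun m => (hp m).1) h1 fun m => by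
        rw [← mul_apply_eq_comp, hpe, hk, zero_smul, zero_apply]
      exact this ▸ zero_mem _
    · push Not at hk
      obtain ⟨m, hm⟩ := hk
      refine (hpd m).1 ⟨(c m k)⁻¹ • e k ξ, ?_⟩
      change p m ((c m k)⁻¹ • e k ξ) = e k ξ
      rw [map_smul, ← mul_apply_eq_comp, hpe, smul_apply, inv_smul_smul₀ hm]
  have hd : x.domain = ⊤ := by
    refine top_unique fun ξ _ => ?_
    have : ξ = ∑ k, e k ξ := by rw [← sum_apply, hsum, one_apply_eq_self]
    rw [this]
    exact sum_mem fun k _ => hle k ⟨ξ, rfl⟩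
  obtain ⟨y, rfl⟩ := exists_eq_ofBounded hc hd
  exact ⟨y, mem_of_affiliated ha, rfl⟩

/-- The vector norm of a bounded operator, over a finite-dimensional center. -/
theorem isVectorNorm_central_sum {M : VonNeumannAlgebra H} {n : ℕ} {e : Fin n → H →L[ℂ] H}
    (hfd : FiniteDimensional ℂ (center M).toStarSubalgebra)
    (he : ∀ i, IsProj (center M) (e i)) (h0 : ∀ i, e i ≠ 0)
    (ho : ∀ i j, i ≠ j → e i * e j = 0) (hsum : ∑ i, e i = 1)
    (hspan : ∀ x ∈ center M, ∃ c : Fin n → ℂ, x = ∑ i, c i • e i)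
    {w : H →L[ℂ] H} (hw : w ∈ M) :
    ∃ c : Fin n → ℂ, (∀ i, ‖c i‖ ≤ ‖w‖) ∧
      IsVectorNorm M (ofBounded w) (ofBounded (∑ i, c i • e i)) ∧
      ∀ f, IsVectorNorm M (ofBounded w) f → ∃ f' ∈ center M, f = ofBounded f' ∧ ‖w‖ ≤ ‖f'‖ := by
  set b := CFC.sqrt (star w * w) with hbdef
  have hb : 0 ≤ b := CFC.sqrt_nonneg _
  have hbb : b * b = star w * w := CFC.sqrt_mul_sqrt_self _ (star_mul_self_nonneg w)
  have huniq : ∀ b' : H →L[ℂ] H, 0 ≤ b' → b' * b' = star w * w → b' = b := by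
    intro b' hb' h
    rw [hbdef, ← h, CFC.sqrt_mul_self b' hb']
  have hnorm : ‖b‖ = ‖w‖ := norm_eq_of_mul_self_eq hb hbb
  have hcomm : ∀ i, Commute b (e i) := fun i => by
    refine commute_of_commute_mul_self hb ?_
    rw [hbb]
    exact (mem_center_iff.1 (he i).2).2 _ (mul_mem (star_mem hw) hw)
  set c : Fin n → ℂ := fun i => (‖e i * b * e i‖ : ℂ)
  have hle : b ≤ ∑ i, c i • e i := le_central_sum (fun i => (he i).1) hsum hb hcomm
  have hcM : ∑ i, c i • e i ∈ center M := sum_mem fun i _ => smul_mem_of_mem _ _ (he i).2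
  have hcs : IsSelfAdjoint (∑ i, c i • e i) := IsSelfAdjoint.of_nonneg (hb.trans hle)
  have hmin : ∀ g ∈ measurableOps (center M), OpLE (ofBounded b) g →
      OpLE (ofBounded (∑ i, c i • e i)) g := by
    intro g hg hbg
    obtain ⟨g', hg', rfl⟩ := exists_eq_ofBounded_of_measurable_center hfd hg
    rw [opLE_ofBounded] at hbg ⊢
    refine ⟨hcs, hbg.2.1, ?_⟩
    obtain ⟨d, rfl⟩ := hspan g' hg'
    exact central_sum_le (fun i => (he i).1) h0 ho hb hbg.2.2
  have hop : OpLE (ofBounded b) (ofBounded (∑ i, c i • e i)) :=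
    opLE_ofBounded.2 ⟨IsSelfAdjoint.of_nonneg hb, hcs, hle⟩
  refine ⟨c, fun i => ?_, ⟨ofBounded b, isAbs_ofBounded.2 ⟨b, rfl, hb, hbb⟩,
    ofBounded_mem_measurableOps hcM, hmin, fun f' hf' h => h _ (ofBounded_mem_measurableOps hcM) hop⟩,
    ?_⟩
  · have h1 := norm_le_one_of_isStarProjection (he i).1
    have h2 : ‖e i * b * e i‖ ≤ 1 * ‖b‖ * 1 := (norm_mul_le _ _).trans
      (mul_le_mul ((norm_mul_le _ _).trans (mul_le_mul_of_nonneg_right h1 (norm_nonneg _))) h1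
        (norm_nonneg _) (by positivity))
    rw [one_mul, mul_one, hnorm] at h2
    simpa [c] using h2
  -- The central sum is a lower bound of the majorants of `b`, so any infimum `f` dominates it and
  -- therefore dominates `b`; this gives the norm bound.
  · rintro f ⟨a, ha, hf, -, hglb⟩
    obtain ⟨b', rfl, hb', hbb'⟩ := isAbs_ofBounded.1 ha
    obtain rfl := huniq b' hb' hbb'
    obtain ⟨f', hf', rfl⟩ := exists_eq_ofBounded_of_measurable_center hfd hf
    refine ⟨f', hf', rfl, ?_⟩
    have h1 := hglb _ (ofBounded_mem_measurableOps hcM) hmin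
    rw [opLE_ofBounded] at h1
    rw [← hnorm]
    exact CStarAlgebra.norm_le_norm_of_nonneg_of_le hb (hle.trans h1.2.2)

end VectorNorm

/-! ### Comparison of $t_c(M)$ with the norm topology. -/

section Topology

open MeasureTheory

variable {H : Type u} [NormedAddCommGroup H] [InnerProductSpace ℂ H] [CompleteSpace H]
variable {M : VonNeumannAlgebra H} {Ω : Type v} [MeasurableSpace Ω] {μ : Measure Ω}

/-- The case `e = 1` already determines `g`; multiplicativity of the identification gives the
converse. -/
theorem CenterModel.corresponds_ofBounded (Φ : CenterModel M μ) {f : H →L[ℂ] H} (hf : f ∈ center M)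
    {g : Ω →ₘ[μ] ℂ} : Φ.Corresponds (ofBounded f) g ↔ g = Φ.toHom ⟨f, hf⟩ := by
  constructor
  · rintro ⟨-, h⟩
    have := h 1 ⟨f, hf⟩ (by
      rw [strongMul_ofBounded]
      exact congrArg ofBounded (one_mul f))
    rw [this, Φ.map_one, one_mul]
  · rintro rfl
    refine ⟨ofBounded_mem_measurableOps hf, fun e y h => ?_⟩
    rw [strongMul_ofBounded, ofBounded_inj] at h
    rw [← Φ.map_mul]
    congr 1
    exact Subtype.ext h.symm

theorem ae_norm_le_one_of_mul_self {g : Ω →ₘ[μ] ℂ} (h : g * g = g) : ∀ᵐ ω ∂μ, ‖g ω‖ ≤ 1 := by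
  have h1 := AEEqFun.coeFn_mul g g
  rw [h] at h1
  filter_upwards [h1] with ω hω
  rw [Pi.mul_apply] at hω
  obtain h0 | h0 := eq_or_ne (g ω) 0
  · simp [h0]
  · have : g ω = 1 := by
      apply mul_left_cancel₀ h0
      rw [← hω, mul_one]
    simp [this]

/-- Upper bound for the function of a central operator. -/
theorem CenterModel.sum_mem_nhdW (Φ : CenterModel M μ) {n : ℕ}
    {e : Fin n → (center M).toStarSubalgebra} (he : ∀ i, e i * e i = e i) {c : Fin n → ℂ}
    {ε δ : ℝ} (hc : ∑ i, ‖c i‖ ≤ ε) {A : Set Ω} (hA : MeasurableSet A) :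
    Φ.toHom (∑ i, c i • e i) ∈ nhdW μ A ε δ := by
  -- The bound holds almost everywhere, so nothing has to be removed from `A` and `δ` plays no role.
  refine ⟨A, hA, subset_rfl, by simp, ?_⟩
  have h1 : ∀ s : Finset (Fin n), ∀ᵐ ω ∂μ,
      ‖Φ.toHom (∑ i ∈ s, c i • e i) ω‖ ≤ ∑ i ∈ s, ‖c i‖ := by
    intro s
    induction s using Finset.cons_induction with
    | empty =>
      rw [Finset.sum_empty, map_zero]
      filter_upwards [AEEqFun.coeFn_zero (μ := μ) (α := Ω) (β := ℂ)] with ω hω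
      simp [hω]
    | cons i s hi ih =>
      rw [Finset.sum_cons, Finset.sum_cons, map_add, map_smul]
      have hidem : Φ.toHom (e i) * Φ.toHom (e i) = Φ.toHom (e i) := by rw [← Φ.map_mul, he]
      filter_upwards [ih, AEEqFun.coeFn_add (c i • Φ.toHom (e i)) (Φ.toHom (∑ i ∈ s, c i • e i)),
        AEEqFun.coeFn_smul (c i) (Φ.toHom (e i)), ae_norm_le_one_of_mul_self hidem]
        with ω h2 h3 h4 h5
      rw [h3, Pi.add_apply, h4, Pi.smul_apply]
      refine (norm_add_le _ _).trans (add_le_add ?_ h2)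
      rw [norm_smul]
      exact mul_le_of_le_one_right (norm_nonneg _) h5
  refine (eLpNorm_indicator_le _).trans ?_
  rw [eLpNorm_exponent_top]
  refine eLpNormEssSup_le_of_ae_bound ?_
  filter_upwards [h1 Finset.univ] with ω hω
  exact hω.trans hc

/-- Lower bound for the function of a central operator: a neighbourhood `W(A, ε, δ)` controls all
coefficients, for suitable `A` and `δ`. -/
theorem CenterModel.exists_norm_le_of_mem_nhdW (Φ : CenterModel M μ) (hμ : DirectSumProperty μ)
    {n : ℕ} {e : Fin n → (center M).toStarSubalgebra} (h0 : ∀ i, e i ≠ 0) :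
    ∃ (A : Set Ω) (δ : ℝ), MeasurableSet A ∧ μ A < ∞ ∧ 0 < δ ∧
      ∀ (f : (center M).toStarSubalgebra) (c : Fin n → ℂ) (ε : ℝ), 0 ≤ ε →
        (∀ i, f * e i = c i • e i) → Φ.toHom f ∈ nhdW μ A ε δ → ∀ i, ‖c i‖ ≤ ε := by
  let S : Fin n → Set Ω := fun i => {ω | Φ.toHom (e i) ω ≠ 0}
  have hS : ∀ i, MeasurableSet (S i) := fun i =>
    ((Φ.toHom (e i)).stronglyMeasurable.measurable (measurableSet_singleton 0)).compl
  have hS0 : ∀ i, μ (S i) ≠ 0 := by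
    intro i hi
    refine h0 i (Φ.injective ?_)
    rw [map_zero]
    refine AEEqFun.ext ?_
    have : ∀ᵐ ω ∂μ, Φ.toHom (e i) ω = 0 := by
      rw [ae_iff]
      exact hi
    filter_upwards [this, AEEqFun.coeFn_zero (μ := μ) (α := Ω) (β := ℂ)] with ω h1 h2
    rw [h1, h2, Pi.zero_apply]
  -- The support of `e i` may have infinite measure; the second clause of `DirectSumProperty` lets a
  -- set of finite measure detect it.
  have hB : ∀ i, ∃ B, MeasurableSet B ∧ μ B < ∞ ∧ μ (S i ∩ B) ≠ 0 := by
    intro i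
    by_contra! hc
    exact hS0 i (hμ.2 (S i) (hS i) hc)
  choose B hBm hBf hBS using hB
  -- With `δ` below all these measures, removing a set of measure at most `δ` leaves a non-null part
  -- of every support.
  obtain ⟨δ, hδ, hδB⟩ : ∃ δ : ℝ, 0 < δ ∧ ∀ i, ENNReal.ofReal δ < μ (S i ∩ B i) := by
    have h1 : ∀ i, ∃ δ : ℝ, 0 < δ ∧ ENNReal.ofReal δ < μ (S i ∩ B i) := by
      intro i
      obtain ⟨r, hr0, hr⟩ := ENNReal.lt_iff_exists_nnreal_btwn.1 (pos_iff_ne_zero.2 (hBS i))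
      exact ⟨r, by exact_mod_cast hr0, by rwa [ENNReal.ofReal_coe_nnreal]⟩
    choose d hd hd' using h1
    obtain hn | hn := isEmpty_or_nonempty (Fin n)
    · exact ⟨1, one_pos, fun i => hn.elim i⟩
    · obtain ⟨i₀, hi₀⟩ := Finite.exists_min d
      exact ⟨d i₀, hd i₀, fun i => (ENNReal.ofReal_le_ofReal (hi₀ i)).trans_lt (hd' i)⟩
  refine ⟨⋃ i, B i, δ, MeasurableSet.iUnion hBm, ?_, hδ, ?_⟩
  · exact (measure_iUnion_fintype_le μ B).trans_lt (ENNReal.sum_lt_top.2 fun i _ => hBf i)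
  · rintro f c ε hε hf ⟨C, hC, -, hCδ, hCε⟩ i
    have hne : μ (S i ∩ B i ∩ C) ≠ 0 := by
      intro hz
      refine (hδB i).not_ge ?_
      calc μ (S i ∩ B i) ≤ μ (((⋃ i, B i) \ C) ∪ (S i ∩ B i ∩ C)) := by
            refine measure_mono fun ω hω => ?_
            by_cases h : ω ∈ C
            · exact Or.inr ⟨hω, h⟩
            · exact Or.inl ⟨Set.mem_iUnion.2 ⟨i, hω.2⟩, h⟩
        _ ≤ _ := measure_union_le _ _
        _ ≤ _ := by rw [hz, add_zero]; exact hCδ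
    have h1 : ∀ᵐ ω ∂μ, ‖C.indicator (Φ.toHom f) ω‖ₑ ≤ ENNReal.ofReal ε := by
      rw [eLpNorm_exponent_top] at hCε
      filter_upwards [ae_le_eLpNormEssSup (f := C.indicator (Φ.toHom f)) (μ := μ)] with ω hω
      exact hω.trans hCε
    have h2 : ∀ᵐ ω ∂μ, Φ.toHom f ω * Φ.toHom (e i) ω = c i * Φ.toHom (e i) ω := by
      have h3 : Φ.toHom f * Φ.toHom (e i) = c i • Φ.toHom (e i) := by
        rw [← Φ.map_mul, hf, map_smul]
      have h4 := AEEqFun.coeFn_mul (Φ.toHom f) (Φ.toHom (e i))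
      rw [h3] at h4
      filter_upwards [h4, AEEqFun.coeFn_smul (c i) (Φ.toHom (e i))] with ω h5 h6
      rw [Pi.mul_apply] at h5
      rw [← h5, h6, Pi.smul_apply, smul_eq_mul]
    -- At almost every point of this non-null set the function of `f` takes the value `c i` and is
    -- bounded by `ε`.
    have h7 : ∃ᵐ ω ∂μ, ω ∈ S i ∩ B i ∩ C := frequently_ae_mem_iff.2 hne
    obtain ⟨ω, hω, h8, h9⟩ := (h7.and_eventually (h1.and h2)).exists
    rw [Set.indicator_of_mem hω.2, mul_right_cancel₀ hω.1.1 h9, ← ofReal_norm,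
      ENNReal.ofReal_le_ofReal_iff hε] at h8
    exact h8

/-- The filter which defines the neighbourhoods in `t_c(M)` is the norm neighbourhood filter. -/
theorem CenterModel.iInf_nhdOAt_eq (Φ : CenterModel M μ) (hμ : DirectSumProperty μ)
    (hfd : FiniteDimensional ℂ (center M).toStarSubalgebra) (x : M) :
    (⨅ (A : Set Ω) (_ : MeasurableSet A) (_ : μ A < ∞) (ε : ℝ) (_ : 0 < ε) (δ : ℝ) (_ : 0 < δ),
      Filter.principal (Φ.nhdOAt (toCentralExtension M x) A ε δ)) =
      Filter.map (toCentralExtension M) (nhds x) := by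
  have hE := centralExtension_eq_of_finiteDimensional hfd
  obtain ⟨n, e, he, h0, ho, hsum, hspan⟩ := exists_minimal_central_projections M hfd
  let e' : Fin n → (center M).toStarSubalgebra := fun i => ⟨e i, (he i).2⟩
  have hVN := fun {w} => isVectorNorm_central_sum hfd he h0 ho hsum hspan (w := w)
  have hcoe : ∀ c : Fin n → ℂ, ((∑ i, c i • e' i : (center M).toStarSubalgebra) : H →L[ℂ] H) =
      ∑ i, c i • e i := fun c => by simp [e']
  refine le_antisymm ?_ ?_
  · intro s hs
    obtain ⟨r, hr, hrs⟩ := Metric.mem_nhds_iff.1 (Filter.mem_map.1 hs)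
    obtain ⟨A, δ, hA, hAμ, hδ, hAδ⟩ := Φ.exists_norm_le_of_mem_nhdW hμ (e := e')
      fun i hi => h0 i (congrArg Subtype.val hi)
    -- The norm of a sum of `n` terms is estimated by the triangle inequality; `n + 1` makes the
    -- inequality strict and covers `n = 0`.
    have hε : 0 < r / (n + 1) := by positivity
    have hsub : Φ.nhdOAt (toCentralExtension M x) A (r / (n + 1)) δ ⊆ s := by
      rintro ⟨y, hy⟩ ⟨w, ⟨hwE, f, g, hf, hfg, hg⟩, hyw⟩
      rw [hE] at hwE hy
      obtain ⟨w, hw, rfl⟩ := hwE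
      obtain ⟨y, hyM, rfl⟩ := hy
      obtain ⟨-, -, -, hwf⟩ := hVN hw
      obtain ⟨f, hfM, rfl, hwle⟩ := hwf f hf
      rw [Φ.corresponds_ofBounded hfM] at hfg
      subst hfg
      obtain ⟨c, hc⟩ := hspan f hfM
      have hfe : ∀ i, (⟨f, hfM⟩ : (center M).toStarSubalgebra) * e' i = c i • e' i := by
        intro i
        refine Subtype.ext ?_
        change f * e i = c i • e i
        rw [hc, Finset.sum_mul, Finset.sum_eq_single i, smul_mul_assoc,
          (he i).1.isIdempotentElem.eq]
        · intro j _ hj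
          rw [smul_mul_assoc, ho j i hj, smul_zero]
        · simp
      have hcle := hAδ ⟨f, hfM⟩ c _ hε.le hfe hg
      have hlt : ‖w‖ < r := by
        refine hwle.trans_lt ?_
        rw [hc]
        calc ‖∑ i, c i • e i‖ ≤ ∑ i : Fin n, r / (n + 1) := by
              refine norm_sum_le_of_le _ fun i _ => ?_
              rw [norm_smul]
              exact (mul_le_of_le_one_right (norm_nonneg _)
                (norm_le_one_of_isStarProjection (he i).1)).trans (hcle i)
          _ = n * (r / (n + 1)) := by simp
          _ < (n + 1) * (r / (n + 1)) := by
              exact mul_lt_mul_of_pos_right (by linarith) hε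
          _ = r := by field_simp
      have hyx : y = x + w := by
        change ofBounded y = strongAdd (ofBounded (x : H →L[ℂ] H)) (ofBounded w) at hyw
        rwa [strongAdd_ofBounded, ofBounded_inj] at hyw
      refine hrs (a := ⟨y, hyM⟩) ?_
      rw [Metric.mem_ball, Subtype.dist_eq, dist_eq_norm]
      change ‖y - (x : H →L[ℂ] H)‖ < r
      rwa [hyx, add_sub_cancel_left]
    refine Filter.mem_of_superset ?_ hsub
    refine Filter.le_principal_iff.1 ?_
    exact iInf_le_of_le A (iInf_le_of_le hA (iInf_le_of_le hAμ (iInf_le_of_le _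
      (iInf_le_of_le hε (iInf_le_of_le δ (iInf_le_of_le hδ le_rfl))))))
  · refine le_iInf fun A => le_iInf fun hA => le_iInf fun hAμ => le_iInf fun ε => le_iInf fun hε =>
      le_iInf fun δ => le_iInf fun hδ => ?_
    rw [Filter.le_principal_iff, Filter.mem_map, Metric.mem_nhds_iff]
    refine ⟨ε / (n + 1), by positivity, fun y hy => ?_⟩
    rw [Metric.mem_ball, Subtype.dist_eq, dist_eq_norm] at hy
    have hwM : (y : H →L[ℂ] H) - x ∈ M := sub_mem y.2 x.2
    obtain ⟨c, hc, hf, -⟩ := hVN hwM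
    have hfM : ∑ i, c i • e i ∈ center M := sum_mem fun i _ => smul_mem_of_mem _ _ (he i).2
    refine ⟨ofBounded ((y : H →L[ℂ] H) - x),
      ⟨boundedOps_subset_centralExtension M ⟨_, hwM, rfl⟩, _, _, hf,
        (Φ.corresponds_ofBounded hfM).2 rfl, ?_⟩, ?_⟩
    · have h1 : (⟨∑ i, c i • e i, hfM⟩ : (center M).toStarSubalgebra) = ∑ i, c i • e' i :=
        Subtype.ext (hcoe c).symm
      rw [h1]
      refine Φ.sum_mem_nhdW (fun i => Subtype.ext (he i).1.isIdempotentElem.eq) ?_ hA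
      calc ∑ i, ‖c i‖ ≤ ∑ i : Fin n, ε / (n + 1) :=
            Finset.sum_le_sum fun i _ => (hc i).trans hy.le
        _ = n * (ε / (n + 1)) := by simp
        _ ≤ (n + 1) * (ε / (n + 1)) := by
            exact mul_le_mul_of_nonneg_right (by linarith) (by positivity)
        _ = ε := by field_simp
    · change ofBounded (y : H →L[ℂ] H) = strongAdd (ofBounded (x : H →L[ℂ] H)) (ofBounded _)
      rw [strongAdd_ofBounded, add_sub_cancel]

/-- Over a finite-dimensional center, `t_c(M)` is the norm topology. -/
theorem CenterModel.isHomeomorph_toCentralExtension (Φ : CenterModel M μ)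
    (hμ : DirectSumProperty μ) (hfd : FiniteDimensional ℂ (center M).toStarSubalgebra) :
    @IsHomeomorph M (centralExtension M) inferInstance Φ.tc (toCentralExtension M) := by
  let _ := Φ.tc
  have hn := Φ.iInf_nhdOAt_eq hμ hfd
  have hsurj : Function.Surjective (toCentralExtension M) := by
    rintro ⟨x, hx⟩
    obtain ⟨y, hy, rfl⟩ := (centralExtension_eq_of_finiteDimensional hfd).subset hx
    exact ⟨⟨y, hy⟩, rfl⟩
  -- By definition of `TopologicalSpace.mkOfNhds` a set is open when it belongs to the prescribed
  -- filter at each of its points, so the neighbourhood axioms need not be checked for these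
  -- filters.
  have hopen : ∀ s : Set (centralExtension M),
      IsOpen s ↔
        ∀ x, toCentralExtension M x ∈ s → s ∈ Filter.map (toCentralExtension M) (nhds x) := by
    intro s
    simp_rw [← hn]
    exact ⟨fun h x hx => h _ hx, fun h a ha => by
      obtain ⟨x, rfl⟩ := hsurj a
      exact h x ha⟩
  refine ⟨continuous_def.2 fun s hs => isOpen_iff_mem_nhds.2 fun x hx => (hopen s).1 hs x hx,
    fun s hs => (hopen _).2 fun x hx => ?_, fun x y h => ?_, hsurj⟩
  · obtain ⟨y, hy, hyx⟩ := hx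
    have : y = x := Subtype.ext (ofBounded_injective (congrArg Subtype.val hyx))
    subst this
    exact Filter.image_mem_map (hs.mem_nhds hy)
  · exact Subtype.ext (ofBounded_injective (congrArg Subtype.val h))

end Topology

end CentralExt

theorem mainTheorem3 {H : Type u} [NormedAddCommGroup H] [InnerProductSpace ℂ H] [CompleteSpace H]
    (M : VonNeumannAlgebra H) :
    (CentralExt.centralExtension M = CentralExt.boundedOps M ↔
      CentralExt.IsFiniteDirectSumOfFactors M) ∧
    (CentralExt.IsFiniteDirectSumOfFactors M ↔
      FiniteDimensional ℂ (CentralExt.center M).toStarSubalgebra) ∧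
    (CentralExt.centralExtension M = CentralExt.boundedOps M →
      ∀ {Ω : Type v} [MeasurableSpace Ω] (μ : MeasureTheory.Measure Ω),
        CentralExt.DirectSumProperty μ → ∀ Φ : CentralExt.CenterModel M μ,
          @IsHomeomorph M (CentralExt.centralExtension M) inferInstance Φ.tc
            (CentralExt.toCentralExtension M)) := by
  have h1 := CentralExt.finiteDimensional_center_of_eq (M := M)
  have h2 := CentralExt.isFiniteDirectSumOfFactors_of_finiteDimensional (M := M)
  have h3 := CentralExt.finiteDimensional_of_isFiniteDirectSumOfFactors (M := M)
  have h4 := CentralExt.centralExtension_eq_of_finiteDimensional (M := M)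
  refine ⟨⟨fun h => h2 (h1 h), fun h => h4 (h3 h)⟩, ⟨h3, h2⟩, fun h _ _ μ hμ Φ => ?_⟩
  exact Φ.isHomeomorph_toCentralExtension hμ (h1 h)
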